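/- A planar diagram code describes a knot diagram on the sphere whose edges carry labels: $X[a,b,c,d]$ denotes a crossing at which the edges $a,b,c,d$ occur in this counterclockwise order and at which the strand from $a$ to $c$ passes under the strand from $b$ to $d$. For $n\in\mathbb{Z}$ put $m=|2n-1|$ and let $K_n$ be the knot in $S^3$ given by the diagram with the $9+m$ crossings $$X[0,1,2,3],\ X[4,0,5,6],\ X[7,16,8,2],\ X[9,5,10,17+2m],\ X[6,11,1,4],$$ $$X[17,7,12,13],\ X[14,15,3,8],\ X[11,9,13,12],\ X[15,14,16+2m,10]$$ and, for $0\le i<m$, the half twists $$X[16+2i,\,17+2i,\,19+2i,\,18+2i]\ \text{ if } n>0,\qquad X[17+2i,\,19+2i,\,18+2i,\,16+2i]\ \text{ if } n\le 0 .$$ (Thus $K_n$ is obtained from an alternating diagram of $K_1=10_{97}$ by replacing one crossing, at which the two strands run antiparallel, by $2n-1$ half twists; $K_0=\overline{3_1}\#4_1$, where $\overline{3_1}$ is the right-handed trefoil.) Let $cr(K)$ be the crossing number of a knot $K$, i.e. the least number of crossings of a diagram of $K$. **Lemma 3.4.** For the knots $K_n$ $(n\in\mathbb{Z})$: $cr(K_n)=2n+8$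 for $n>0$; $cr(K_0)=7$; and $-2n+7\le cr(K_n)\le -2n+10$ for $n<0$. -/

import Mathlib

/-!
# Knots, crossing numbers, and the knots `K n`

Knots are treated combinatorially: a knot is a class of knot diagrams on the (oriented) sphere
modulo the Reidemeister moves. Diagrams are written as planar diagram codes.
-/

/-- The vertices of a diagram code. Natural numbers are names of edges.
* `crossing a b c d`: a crossing at which the edges `a, b, c, d` arrive in this counterclockwise
  order; the strand `a`-`c` passes under the strand `b`-`d`.
* `path a b`: a point in the interior of a strand, where the edges `a` and `b` meet (such points
  only subdivide the diagram; the code `[path a a]` is the circle without crossings). -/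
inductive Node : Type where
  | crossing (a b c d : ℕ) : Node
  | path (a b : ℕ) : Node
  deriving DecidableEq

namespace Node

/-- The edges at a vertex, in counterclockwise order. -/
def edges : Node → List ℕ
  | crossing a b c d => [a, b, c, d]
  | path a b => [a, b]

def isCrossing : Node → Bool
  | crossing _ _ _ _ => true
  | path _ _ => false

/-- Renaming of edges. -/
def rename (f : ℕ → ℕ) : Node → Node
  | crossing a b c d => crossing (f a) (f b) (f c) (f d)
  | path a b => path (f a) (f b)

/-- The strand that comes along the edge `x` leaves the vertex along the edge `y`
(recorded for one of the two directions of travel). -/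
def Passes (x y : ℕ) : Node → Prop
  | crossing a b c d => (x = a ∧ y = c) ∨ (x = b ∧ y = d)
  | path a b => x = a ∧ y = b

end Node

/-- A diagram code: the list of the vertices of a diagram. -/
abbrev Code : Type := List Node

namespace Code

/-- All edges of a code, listed once for each of their ends. -/
def edges (D : Code) : List ℕ := D.flatMap Node.edges

/-- The number of crossings. -/
def crossings (D : Code) : ℕ := D.countP Node.isCrossing

/-- An end of an edge at a vertex: a vertex, and a place in its counterclockwise list of edges. -/
def Dart (D : Code) : Type := Σ i : Fin D.length, Fin (D.get i).edges.length

namespace Dart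

variable {D : Code}

/-- The edge of which `x` is an end. -/
def edge (x : Dart D) : ℕ := (D.get x.1).edges.get x.2

/-- The counterclockwise next edge end at the same vertex. -/
def next (x : Dart D) : Dart D :=
  ⟨x.1, ⟨(x.2.val + 1) % (D.get x.1).edges.length, Nat.mod_lt _ x.2.pos⟩⟩

end Dart

/-- A dart `x` also stands for the corner between `x` and `x.next`. The corners `x` and `y` are
consecutive corners of a region when `x.next` and `y` are the two ends of one edge. -/
def ConsecutiveCorners (D : Code) (x y : Dart D) : Prop :=
  x.next ≠ y ∧ x.next.edge = y.edge

/-- The regions (faces) of the oriented surface which carries the diagram. -/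
def Region (D : Code) : Type := Quot (ConsecutiveCorners D)

/-- `D` is the code of a knot diagram on the sphere:
every edge has two ends; travelling along strands one gets from every edge to every other edge,
so there is exactly one component; and the surface obtained by gluing discs to the diagram along
its regions is a sphere. With `v` vertices, `c` of them crossings, there are `v + c` edges, so
Euler's formula `v - (v + c) + r = 2` says that there are `c + 2` regions. -/
structure IsKnotDiagram (D : Code) : Prop where
  two_ends : ∀ a ∈ D.edges, D.edges.count a = 2
  nonempty : D ≠ []
  one_component : ∀ a ∈ D.edges, ∀ b ∈ D.edges,
    Relation.EqvGen (fun x y => ∃ v ∈ D, v.Passes x y) a b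
  planar : Nat.card (Region D) = D.crossings + 2

/-- Elementary changes of codes. The first five only change the way in which a diagram is written
down, the others are the Reidemeister moves. -/
inductive Move : Code → Code → Prop
  /-- The order of the vertices does not matter. -/
  | reorder (D D' : Code) : D.Perm D' → Move D D'
  /-- The names of the edges do not matter. -/
  | rename (D : Code) (f : ℕ → ℕ) : Function.Injective f → Move D (D.map (Node.rename f))
  /-- The list of edges at a crossing may start with either end of the lower strand. -/
  | turn (a b c d : ℕ) (D : Code) : Move (.crossing a b c d :: D) (.crossing c d a b :: D)
  | turnPath (a b : ℕ) (D : Code) : Move (.path a b :: D) (.path b a :: D)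
  /-- Two different edges `a`, `b` which meet at a point of a strand may be merged. -/
  | merge (a b : ℕ) (D : Code) : a ≠ b →
      Move (.path a b :: D) (D.map (Node.rename fun x => if x = b then a else x))
  /-- First Reidemeister move: removal of a kink `x`; there are two kinds of kinks. -/
  | r1 (x a b : ℕ) (D : Code) : Move (.crossing x x a b :: D) (.path a b :: D)
  | r1' (x a b : ℕ) (D : Code) : Move (.crossing a x x b :: D) (.path a b :: D)
  /-- Second Reidemeister move: the strand `a`-`x`-`b` lies over the strand `c`-`y`-`d`, and
  `x`, `y` bound a bigon. -/
  | r2 (a b c d x y : ℕ) (D : Code) :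
      Move (.crossing c x y a :: .crossing y x d b :: D) (.path a b :: .path c d :: D)
  /-- Third Reidemeister move: three strands with the ends `p0`-`p3`, `p1`-`p4`, `p2`-`p5`, where
  `p0, …, p5` is the counterclockwise order of the ends, and `x, y, z` bound a triangle.
  Here `p0`-`p3` is the top strand and `p1`-`p4` the middle one. -/
  | r3 (p0 p1 p2 p3 p4 p5 x y z : ℕ) (D : Code) :
      Move (.crossing p1 x y p0 :: .crossing p2 p3 z x :: .crossing p5 y z p4 :: D)
        (.crossing p2 x y p1 :: .crossing p4 z x p3 :: .crossing p5 p0 y z :: D)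
  /-- The same, where `p0`-`p3` is the top strand and `p2`-`p5` the middle one. -/
  | r3' (p0 p1 p2 p3 p4 p5 x y z : ℕ) (D : Code) :
      Move (.crossing p1 x y p0 :: .crossing p2 p3 z x :: .crossing p4 p5 y z :: D)
        (.crossing p1 p2 x y :: .crossing p4 z x p3 :: .crossing p5 p0 y z :: D)

end Code

/-- Knot diagrams on the sphere. -/
def KnotDiagram : Type := {D : Code // D.IsKnotDiagram}

/-- Two knot diagrams present the same knot if they are connected by a finite sequence of
Reidemeister moves, in either direction, through knot diagrams. -/
def KnotDiagram.setoid : Setoid KnotDiagram :=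
  Relation.EqvGen.setoid fun D D' => Code.Move D.1 D'.1

/-- Knots (unoriented; a knot and its mirror image are not identified). -/
def Knot : Type := Quotient KnotDiagram.setoid

/-- The knot presented by a diagram. -/
def KnotDiagram.knot (D : KnotDiagram) : Knot := Quotient.mk KnotDiagram.setoid D

/-- The crossing number of a knot: the least number of crossings of its diagrams. -/
noncomputable def Knot.crossingNumber (K : Knot) : ℕ :=
  sInf {c | ∃ D : KnotDiagram, D.knot = K ∧ D.1.crossings = c}

namespace TwistFamily

/-- The part of the diagram of `K n` outside the box: nine crossings with the four ends
`16` (lower left), `17` (lower right), `s` (upper left), `t` (upper right) at the box. -/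
def outside (s t : ℕ) : Code :=
  [.crossing 0 1 2 3, .crossing 4 0 5 6, .crossing 7 16 8 2, .crossing 9 5 10 t,
   .crossing 6 11 1 4, .crossing 17 7 12 13, .crossing 14 15 3 8, .crossing 11 9 13 12,
   .crossing 15 14 s 10]

/-- The half twist number `i` in the box, counted from below. It has the lower ends `16 + 2 * i`
(left), `17 + 2 * i` (right) and the upper ends `18 + 2 * i` (left), `19 + 2 * i` (right).
There are two kinds of half twists; in the first one the strand from the lower left to the upper
right passes under. -/
def halfTwist (positive : Bool) (i : ℕ) : Node :=
  if positive then .crossing (16 + 2 * i) (17 + 2 * i) (19 + 2 * i) (18 + 2 * i)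
  else .crossing (17 + 2 * i) (19 + 2 * i) (18 + 2 * i) (16 + 2 * i)

/-- The diagram with `m` half twists of the given kind in the box. -/
def code (positive : Bool) (m : ℕ) : Code :=
  outside (16 + 2 * m) (17 + 2 * m) ++ (List.range m).map (halfTwist positive)

theorem count_twists (p : Bool) (m a : ℕ) :
    (((List.range m).map (halfTwist p)).flatMap Node.edges).count a =
      (if 16 ≤ a ∧ a < 16 + 2 * m then 1 else 0) + (if 18 ≤ a ∧ a < 18 + 2 * m then 1 else 0) := by
  induction m with
  | zero => simp only [List.range_zero, List.map_nil, List.flatMap_nil, List.count_nil]; split_ifs <;> omega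
  | succ m ih =>
    rw [List.range_succ, List.map_append, List.flatMap_append, List.count_append, ih]
    cases p <;> simp [halfTwist, Node.edges, List.count_cons] <;> split_ifs <;> omega

theorem count_outside (s t a : ℕ) : ((outside s t).flatMap Node.edges).count a =
    (if a < 16 then 2 else if a < 18 then 1 else 0) + (if s = a then 1 else 0) +
      (if t = a then 1 else 0) := by
  have h : (outside s t).flatMap Node.edges = [0, 1, 2, 3, 4, 0, 5, 6, 7, 16, 8, 2, 9, 5, 10] ++
    [t] ++ [6, 11, 1, 4, 17, 7, 12, 13, 14, 15, 3, 8, 11, 9, 13, 12, 15, 14] ++ [s] ++ [10] := rfl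
  have e : List.count a [0, 1, 2, 3, 4, 0, 5, 6, 7, 16, 8, 2, 9, 5, 10] +
      List.count a [6, 11, 1, 4, 17, 7, 12, 13, 14, 15, 3, 8, 11, 9, 13, 12, 15, 14] +
      List.count a [10] = if a < 16 then 2 else if a < 18 then 1 else 0 := by
    by_cases h1 : a < 18
    · revert a
      decide
    · have e1 : ∀ k, k < 18 → (k = a) = False := fun k hk => by simp; omega
      rw [if_neg (by omega), if_neg (by omega)]
      simp [e1]
  rw [h, ← e]
  simp only [List.count_append, List.count_singleton, beq_iff_eq]
  ring

theorem two_ends (p : Bool) (m : ℕ) (hm : 1 ≤ m) :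
    ∀ a ∈ (code p m).edges, (code p m).edges.count a = 2 := by
  intro a ha
  have hpos := List.count_pos_iff.2 ha
  revert hpos
  unfold Code.edges code
  rw [List.flatMap_append, List.count_append, count_twists, count_outside]
  split_ifs <;> omega

theorem one_component (p : Bool) (m : ℕ) (hm : Odd m) :
    ∀ a ∈ (code p m).edges, ∀ b ∈ (code p m).edges,
      Relation.EqvGen (fun x y => ∃ v ∈ code p m, v.Passes x y) a b := by
  set R := Relation.EqvGen (fun x y => ∃ v ∈ code p m, v.Passes x y) with hR
  have hE : Equivalence R := Relation.EqvGen.is_equivalence _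
  have hout : ∀ a b c d, Node.crossing a b c d ∈ outside (16 + 2 * m) (17 + 2 * m) →
      R a c ∧ R b d := fun a b c d h =>
    ⟨.rel _ _ ⟨_, List.mem_append_left _ h, Or.inl ⟨rfl, rfl⟩⟩,
      .rel _ _ ⟨_, List.mem_append_left _ h, Or.inr ⟨rfl, rfl⟩⟩⟩
  have htw : ∀ i < m, R (16 + 2 * i) (19 + 2 * i) ∧ R (17 + 2 * i) (18 + 2 * i) := by
    intro i hi
    have hmem : halfTwist p i ∈ code p m :=
      List.mem_append_right _ (List.mem_map.2 ⟨i, List.mem_range.2 hi, rfl⟩)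
    cases p
    · exact ⟨hE.symm (.rel _ _ ⟨_, hmem, Or.inr ⟨rfl, rfl⟩⟩), .rel _ _ ⟨_, hmem, Or.inl ⟨rfl, rfl⟩⟩⟩
    · exact ⟨.rel _ _ ⟨_, hmem, Or.inl ⟨rfl, rfl⟩⟩, .rel _ _ ⟨_, hmem, Or.inr ⟨rfl, rfl⟩⟩⟩
  have hlev : ∀ i ≤ m, (Even i → R 16 (16 + 2 * i) ∧ R 17 (17 + 2 * i)) ∧
      (Odd i → R 16 (17 + 2 * i) ∧ R 17 (16 + 2 * i)) := by
    intro i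
    induction i with
    | zero => intro _; exact ⟨fun _ => ⟨hE.refl _, hE.refl _⟩, fun h => by simp at h⟩
    | succ i ih =>
      intro hi
      obtain ⟨h1, h2⟩ := ih (by omega)
      obtain ⟨t1, t2⟩ := htw i (by omega)
      have e1 : 16 + 2 * (i + 1) = 18 + 2 * i := by ring
      have e2 : 17 + 2 * (i + 1) = 19 + 2 * i := by ring
      rw [e1, e2]
      refine ⟨fun h => ?_, fun h => ?_⟩
      · have ho : Odd i := by
          rcases Nat.even_or_odd i with h' | h'
          · exact absurd h (by simpa [Nat.even_add_one] using h')
          · exact h'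
        exact ⟨hE.trans (h2 ho).1 t2, hE.trans (h2 ho).2 t1⟩
      · have ho : Even i := by
          rcases Nat.even_or_odd i with h' | h'
          · exact h'
          · exact absurd h (by simpa [Nat.even_add_one, Nat.odd_add_one] using h')
        exact ⟨hE.trans (h1 ho).1 t1, hE.trans (h1 ho).2 t2⟩
  obtain ⟨u1, u2⟩ := (hlev m le_rfl).2 hm
  have c1 := hout 0 1 2 3 (by simp [outside])
  have c2 := hout 4 0 5 6 (by simp [outside])
  have c3 := hout 7 16 8 2 (by simp [outside])
  have c4 := hout 9 5 10 (17 + 2 * m) (by simp [outside])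
  have c5 := hout 6 11 1 4 (by simp [outside])
  have c6 := hout 17 7 12 13 (by simp [outside])
  have c7 := hout 14 15 3 8 (by simp [outside])
  have c8 := hout 11 9 13 12 (by simp [outside])
  have c9 := hout 15 14 (16 + 2 * m) 10 (by simp [outside])
  have r2 : R 16 2 := c3.2
  have r0 : R 16 0 := hE.trans r2 (hE.symm c1.1)
  have r6 : R 16 6 := hE.trans r0 c2.2
  have r1 : R 16 1 := hE.trans r6 c5.1
  have r3 : R 16 3 := hE.trans r1 c1.2
  have r14 : R 16 14 := hE.trans r3 (hE.symm c7.1)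
  have r10 : R 16 10 := hE.trans r14 c9.2
  have r9 : R 16 9 := hE.trans r10 (hE.symm c4.1)
  have r12 : R 16 12 := hE.trans r9 c8.2
  have r17 : R 16 17 := hE.trans r12 (hE.symm c6.1)
  have rs : R 16 (16 + 2 * m) := hE.trans r17 u2
  have r15 : R 16 15 := hE.trans rs (hE.symm c9.1)
  have r8 : R 16 8 := hE.trans r15 c7.2
  have r7 : R 16 7 := hE.trans r8 (hE.symm c3.1)
  have r13 : R 16 13 := hE.trans r7 c6.2
  have r11 : R 16 11 := hE.trans r13 (hE.symm c8.1)
  have r4 : R 16 4 := hE.trans r11 c5.2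
  have r5 : R 16 5 := hE.trans r4 c2.1
  have hlevel : ∀ i ≤ m, R 16 (16 + 2 * i) ∧ R 16 (17 + 2 * i) := by
    intro i hi
    rcases Nat.even_or_odd i with h | h
    · exact ⟨((hlev i hi).1 h).1, hE.trans r17 ((hlev i hi).1 h).2⟩
    · exact ⟨hE.trans r17 ((hlev i hi).2 h).2, ((hlev i hi).2 h).1⟩
  have hall : ∀ a ∈ (code p m).edges, R 16 a := by
    intro a ha
    by_cases h : a < 16
    · interval_cases a <;> assumption
    · have hle : a < 18 + 2 * m := by
        have h2 := List.count_pos_iff.2 ha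
        unfold Code.edges code at h2
        rw [List.flatMap_append, List.count_append, count_twists, count_outside] at h2
        split_ifs at h2 <;> omega
      obtain ⟨i, hi⟩ : ∃ i, a = 16 + 2 * i ∨ a = 17 + 2 * i := ⟨(a - 16) / 2, by omega⟩
      rcases hi with rfl | rfl
      · exact (hlevel i (by omega)).1
      · exact (hlevel i (by omega)).2
  exact fun a ha b hb => hE.trans (hE.symm (hall a ha)) (hall b hb)

/-! The remaining auxiliary material of this namespace only serves to count the regions. -/

/-- Edges of the darts; the places at the half twists are counted from the lower left end. -/
def lab (m i k : ℕ) : ℕ :=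
  if i < 9 then
    (([[0, 1, 2, 3], [4, 0, 5, 6], [7, 16, 8, 2], [9, 5, 10, 17 + 2 * m], [6, 11, 1, 4],
      [17, 7, 12, 13], [14, 15, 3, 8], [11, 9, 13, 12], [15, 14, 16 + 2 * m, 10]] :
      List (List ℕ)).getD i []).getD k 0
  else ([16 + 2 * (i - 9), 17 + 2 * (i - 9), 19 + 2 * (i - 9), 18 + 2 * (i - 9)] : List ℕ).getD k 0

/-- Numbers of the regions at the corners. -/
def col (m i k : ℕ) : ℕ :=
  if i < 9 then
    (([[0, 1, 2, 3], [0, 3, 4, 5], [10, 8, 2, 1], [4, 3, 10 + m, 9], [4, 1, 0, 5], [10, 1, 6, 9],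
      [7, 3, 2, 8], [4, 9, 6, 1], [7, 8, 10 + m, 3]] : List (List ℕ)).getD i []).getD k 0
  else ([10 + (i - 9), 9, 11 + (i - 9), 8] : List ℕ).getD k 0

/-- A way to tell the two ends of an edge apart. -/
def side (i k : ℕ) : Bool :=
  if i < 9 then
    (([[true, true, true, true], [true, false, true, true], [true, false, true, false],
      [true, false, true, true], [false, true, false, false], [false, false, true, true],
      [true, true, false, false], [false, false, false, false], [false, false, true, false]] :
      List (List Bool)).getD i []).getD k false
  else ([true, true, false, false] : List Bool).getD k false

/-- The dart with given edge and side. -/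
def ofLab (m l : ℕ) (b : Bool) : ℕ × ℕ :=
  if l < 16 then
    if b then ([(0, 0), (0, 1), (0, 2), (0, 3), (1, 0), (1, 2), (1, 3), (2, 0), (2, 2), (3, 0),
      (3, 2), (4, 1), (5, 2), (5, 3), (6, 0), (6, 1)] : List (ℕ × ℕ)).getD l (0, 0)
    else ([(1, 1), (4, 2), (2, 3), (6, 2), (4, 3), (3, 1), (4, 0), (5, 1), (6, 3), (7, 1),
      (8, 3), (7, 0), (7, 3), (7, 2), (8, 1), (8, 0)] : List (ℕ × ℕ)).getD l (0, 0)
  else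
    if b then
      if l = 16 + 2 * m then (8, 2) else if l = 17 + 2 * m then (3, 3)
      else (9 + (l - 16) / 2, l % 2)
    else
      if l = 16 then (2, 1) else if l = 17 then (5, 0)
      else (8 + (l - 16) / 2, 3 - l % 2)

/-- The number of the region which follows a given end of an edge. -/
def colLab (m l : ℕ) (b : Bool) : ℕ :=
  if l < 16 then
    if b then ([0, 1, 2, 3, 0, 4, 5, 10, 2, 4, 10 + m, 1, 6, 9, 7, 3] : List ℕ).getD l 0
    else ([3, 0, 1, 2, 5, 3, 4, 1, 8, 9, 3, 4, 1, 6, 8, 7] : List ℕ).getD l 0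
  else
    if b then if l % 2 = 0 then 10 + (l - 16) / 2 else 9
    else if l % 2 = 0 then 8 else 10 + (l - 16) / 2

theorem ofLab_lab (m i k : ℕ) (hi : i < 9 + m) (hk : k < 4) :
    ofLab m (lab m i k) (side i k) = (i, k) := by
  by_cases h : i < 9
  · interval_cases i <;> interval_cases k <;> simp [lab, side, ofLab] <;> omega
  · obtain ⟨j, rfl⟩ : ∃ j, i = 9 + j := ⟨i - 9, by omega⟩
    interval_cases k <;> simp [lab, side, ofLab] <;> split_ifs <;> (try simp) <;> omega

theorem col_eq (m i k : ℕ) (hk : k < 4) : col m i k = colLab m (lab m i k) (side i k) := by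
  by_cases h : i < 9
  · interval_cases i <;> interval_cases k <;> simp [lab, side, col, colLab] <;>
      (try split_ifs) <;> omega
  · obtain ⟨j, rfl⟩ : ∃ j, i = 9 + j := ⟨i - 9, by omega⟩
    interval_cases k <;> simp [lab, side, col, colLab] <;>
      (try split_ifs) <;> omega

theorem col_eq' (m i k : ℕ) (hk : k < 4) :
    col m i k = colLab m (lab m i ((k + 1) % 4)) (!side i ((k + 1) % 4)) := by
  by_cases h : i < 9
  · interval_cases i <;> interval_cases k <;> simp [lab, side, col, colLab] <;>
      (try split_ifs) <;> omega
  · obtain ⟨j, rfl⟩ : ∃ j, i = 9 + j := ⟨i - 9, by omega⟩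
    interval_cases k <;> simp [lab, side, col, colLab] <;>
      (try split_ifs) <;> omega

theorem col_lt (m i k : ℕ) (hi : i < 9 + m) (hk : k < 4) : col m i k < m + 11 := by
  by_cases h : i < 9
  · interval_cases i <;> interval_cases k <;> simp [col] <;> omega
  · obtain ⟨j, rfl⟩ : ∃ j, i = 9 + j := ⟨i - 9, by omega⟩
    interval_cases k <;> simp [col] <;> omega

/-- The place in the list of edges of a vertex which belongs to the place `k` of `lab`. -/
def place (p : Bool) (i k : ℕ) : ℕ := if i < 9 ∨ p then k else (k + 3) % 4

theorem place_lt (p : Bool) (i k : ℕ) (hk : k < 4) : place p i k < 4 := by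
  unfold place; split_ifs <;> omega

theorem place_succ (p : Bool) (i k : ℕ) :
    (place p i k + 1) % 4 = place p i ((k + 1) % 4) := by
  unfold place; split_ifs <;> omega

theorem place_inj (p : Bool) (i k l : ℕ) (hk : k < 4) (hl : l < 4)
    (h : place p i k = place p i l) : k = l := by
  unfold place at h; split_ifs at h <;> omega

theorem place_surj (p : Bool) (i k : ℕ) (hk : k < 4) : ∃ l < 4, place p i l = k := by
  unfold place
  split_ifs
  · exact ⟨k, hk, rfl⟩
  · exact ⟨(k + 1) % 4, by omega, by omega⟩

theorem length_code (p : Bool) (m : ℕ) : (code p m).length = 9 + m := by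
  simp [code, outside]
  omega

theorem length_edges (p : Bool) (m : ℕ) (i : Fin (code p m).length) :
    ((code p m).get i).edges.length = 4 := by
  have h := List.get_mem (code p m) i
  generalize (code p m).get i = v at h
  rcases List.mem_append.1 h with h | h
  · simp only [outside, List.mem_cons, List.not_mem_nil, or_false] at h
    rcases h with rfl | rfl | rfl | rfl | rfl | rfl | rfl | rfl | rfl <;> rfl
  · obtain ⟨j, -, rfl⟩ := List.mem_map.1 h
    cases p <;> rfl

/-- The dart at the vertex `i` and the place `k` of `lab`. -/
def dart (p : Bool) (m i k : ℕ) (hi : i < 9 + m) (hk : k < 4) : (code p m).Dart :=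
  ⟨⟨i, by rw [length_code]; exact hi⟩, ⟨place p i k, by rw [length_edges]; exact place_lt p i k hk⟩⟩

theorem dart_inj {p : Bool} {m i k j l : ℕ} {hi : i < 9 + m} {hk : k < 4} {hj : j < 9 + m}
    {hl : l < 4} (h : dart p m i k hi hk = dart p m j l hj hl) : (i, k) = (j, l) := by
  have h1 : i = j := congrArg (fun x => x.1.val) h
  have h2 : place p i k = place p j l := congrArg (fun x => x.2.val) h
  subst h1
  rw [place_inj p i k l hk hl h2]

theorem exists_dart (p : Bool) (m : ℕ) (x : (code p m).Dart) :
    ∃ i k hi hk, x = dart p m i k hi hk := by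
  obtain ⟨⟨i, hi⟩, ⟨k, hk⟩⟩ := x
  have hk' : k < 4 := by rw [length_edges] at hk; exact hk
  obtain ⟨l, hl, rfl⟩ := place_surj p i k hk'
  exact ⟨i, l, by rw [length_code] at hi; exact hi, hl, rfl⟩

theorem next_dart (p : Bool) (m i k : ℕ) (hi : i < 9 + m) (hk : k < 4) :
    (dart p m i k hi hk).next = dart p m i ((k + 1) % 4) hi (Nat.mod_lt _ (by omega)) := by
  unfold dart Code.Dart.next
  congr 2
  simp only
  rw [length_edges, place_succ p i k]

theorem edge_dart (p : Bool) (m i k : ℕ) (hi : i < 9 + m) (hk : k < 4) :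
    (dart p m i k hi hk).edge = lab m i k := by
  have h : ∀ x : (code p m).Dart, x.edge =
      ((code p m).getD x.1.val (.path 0 0)).edges.getD x.2.val 0 := by
    rintro ⟨⟨i, hi⟩, ⟨k, hk⟩⟩
    simp only [Code.Dart.edge]
    rw [List.getD_eq_getElem _ _ hi]
    exact (List.getD_eq_getElem _ _ hk).symm
  rw [h]
  change ((code p m).getD i _).edges.getD (place p i k) 0 = _
  by_cases h9 : i < 9
  · simp only [place, h9, true_or, if_true]
    unfold code
    interval_cases i <;> interval_cases k <;> rfl
  · obtain ⟨j, rfl⟩ : ∃ j, i = 9 + j := ⟨i - 9, by omega⟩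
    have hget : (code p m).getD (9 + j) (.path 0 0) = halfTwist p j := by
      unfold code
      rw [List.getD_append_right _ _ _ _ (by simp [outside])]
      have : 9 + j - (outside (16 + 2 * m) (17 + 2 * m)).length = j := by simp [outside]
      rw [this, List.getD_eq_getElem _ _ (by simp; omega)]
      simp
    rw [hget]
    cases p <;> interval_cases k <;> simp [place, halfTwist, Node.edges, lab]

theorem planar (p : Bool) (m : ℕ) (hm : 1 ≤ m) :
    Nat.card (Code.Region (code p m)) = (code p m).crossings + 2 := by
  have hc : (code p m).crossings = 9 + m := by
    rw [← length_code p m]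
    refine List.countP_eq_length.2 fun v h => ?_
    rcases List.mem_append.1 h with h | h
    · simp only [outside, List.mem_cons, List.not_mem_nil, or_false] at h
      rcases h with rfl | rfl | rfl | rfl | rfl | rfl | rfl | rfl | rfl <;> rfl
    · obtain ⟨j, -, rfl⟩ := List.mem_map.1 h
      cases p <;> rfl
  rw [hc]
  let d0 : (code p m).Dart := dart p m 0 0 (by omega) (by omega)
  let q : ℕ → ℕ → Code.Region (code p m) := fun i k =>
    Quot.mk _ (if h : i < 9 + m ∧ k < 4 then dart p m i k h.1 h.2 else d0)
  have hq : ∀ i k hi hk, Quot.mk _ (dart p m i k hi hk) = q i k := by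
    intro i k hi hk
    simp only [q]
    rw [dif_pos ⟨hi, hk⟩]
  have step : ∀ i k j l, i < 9 + m → k < 4 → j < 9 + m → l < 4 → (i, (k + 1) % 4) ≠ (j, l) →
      lab m i ((k + 1) % 4) = lab m j l → q i k = q j l := by
    intro i k j l hi hk hj hl hne he
    rw [← hq i k hi hk, ← hq j l hj hl]
    refine Quot.sound ⟨fun h => ?_, ?_⟩
    · rw [next_dart] at h
      exact hne (dart_inj h)
    · rw [next_dart, edge_dart, edge_dart, he]
  have hcol : ∀ x y, Code.ConsecutiveCorners (code p m) x y →
      ∀ i k hi hk, x = dart p m i k hi hk → ∀ j l hj hl, y = dart p m j l hj hl →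
      col m i k = col m j l := by
    rintro x y ⟨h1, h2⟩ i k hi hk rfl j l hj hl rfl
    rw [next_dart] at h1
    rw [next_dart, edge_dart, edge_dart] at h2
    have hk' : (k + 1) % 4 < 4 := Nat.mod_lt _ (by omega)
    have h3 : side i ((k + 1) % 4) ≠ side j l := by
      intro h3
      have h4 := ofLab_lab m i ((k + 1) % 4) hi hk'
      rw [h2, h3, ofLab_lab m j l hj hl] at h4
      cases h4
      exact h1 rfl
    rw [col_eq' m i k hk, col_eq m j l hl, h2]
    congr 1
    revert h3
    cases side i ((k + 1) % 4) <;> cases side j l <;> simp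
  choose I K hI hK hIK using exists_dart p m
  let F : Code.Region (code p m) → Fin (m + 11) := Quot.lift
    (fun x => ⟨col m (I x) (K x), col_lt m _ _ (hI x) (hK x)⟩)
    (fun x y h => Fin.ext (hcol x y h _ _ _ _ (hIK x) _ _ _ _ (hIK y)))
  have hF : ∀ i k, i < 9 + m → k < 4 → (F (q i k)).val = col m i k := by
    intro i k hi hk
    rw [← hq i k hi hk]
    change col m (I _) (K _) = _
    have h := dart_inj (hIK (dart p m i k hi hk))
    have h1 : I (dart p m i k hi hk) = i := (congrArg Prod.fst h).symm
    have h2 : K (dart p m i k hi hk) = k := (congrArg Prod.snd h).symm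
    rw [h1, h2]
  -- a corner of each region
  let rep : ℕ → ℕ × ℕ := fun c =>
    if c < 11 then ([(0, 0), (0, 1), (0, 2), (0, 3), (1, 2), (1, 3), (5, 2), (6, 0), (2, 1),
      (3, 3), (2, 0)] : List (ℕ × ℕ)).getD c (0, 0) else (c - 2, 2)
  have s := fun i k j l (a : i < 9) (b : k < 4) (c : j < 9) (d : l < 4) =>
    step i k j l (by omega) b (by omega) d
  have a0 : q 0 0 = q 4 2 := s 0 0 4 2 (by omega) (by omega) (by omega) (by omega) (by simp) rfl
  have a1 : q 4 2 = q 1 0 := s 4 2 1 0 (by omega) (by omega) (by omega) (by omega) (by simp) rfl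
  have b0 : q 0 1 = q 2 3 := s 0 1 2 3 (by omega) (by omega) (by omega) (by omega) (by simp) rfl
  have b1 : q 2 3 = q 5 1 := s 2 3 5 1 (by omega) (by omega) (by omega) (by omega) (by simp) rfl
  have b2 : q 5 1 = q 7 3 := s 5 1 7 3 (by omega) (by omega) (by omega) (by omega) (by simp) rfl
  have b3 : q 7 3 = q 4 1 := s 7 3 4 1 (by omega) (by omega) (by omega) (by omega) (by simp) rfl
  have c0 : q 0 2 = q 6 2 := s 0 2 6 2 (by omega) (by omega) (by omega) (by omega) (by simp) rfl
  have c1 : q 6 2 = q 2 2 := s 6 2 2 2 (by omega) (by omega) (by omega) (by omega) (by simp) rfl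
  have d0 : q 0 3 = q 1 1 := s 0 3 1 1 (by omega) (by omega) (by omega) (by omega) (by simp) rfl
  have d1 : q 1 1 = q 3 1 := s 1 1 3 1 (by omega) (by omega) (by omega) (by omega) (by simp) rfl
  have d2 : q 3 1 = q 8 3 := s 3 1 8 3 (by omega) (by omega) (by omega) (by omega) (by simp) rfl
  have d3 : q 8 3 = q 6 1 := s 8 3 6 1 (by omega) (by omega) (by omega) (by omega) (by simp) rfl
  have e0 : q 1 2 = q 4 0 := s 1 2 4 0 (by omega) (by omega) (by omega) (by omega) (by simp) rfl
  have e1 : q 4 0 = q 7 0 := s 4 0 7 0 (by omega) (by omega) (by omega) (by omega) (by simp) rfl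
  have e2 : q 7 0 = q 3 0 := s 7 0 3 0 (by omega) (by omega) (by omega) (by omega) (by simp) rfl
  have f0 : q 1 3 = q 4 3 := s 1 3 4 3 (by omega) (by omega) (by omega) (by omega) (by simp) rfl
  have g0 : q 5 2 = q 7 2 := s 5 2 7 2 (by omega) (by omega) (by omega) (by omega) (by simp) rfl
  have h0 : q 6 0 = q 8 0 := s 6 0 8 0 (by omega) (by omega) (by omega) (by omega) (by simp) rfl
  have l0 : q 2 1 = q 6 3 := s 2 1 6 3 (by omega) (by omega) (by omega) (by omega) (by simp) rfl
  have l1 : q 6 3 = q 8 1 := s 6 3 8 1 (by omega) (by omega) (by omega) (by omega) (by simp) rfl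
  have r0 : q 3 3 = q 7 1 := s 3 3 7 1 (by omega) (by omega) (by omega) (by omega) (by simp) rfl
  have r1 : q 7 1 = q 5 3 := s 7 1 5 3 (by omega) (by omega) (by omega) (by omega) (by simp) rfl
  have x0 : q 9 0 = q 5 0 :=
    step 9 0 5 0 (by omega) (by omega) (by omega) (by omega) (by simp) (by simp [lab])
  have x1 : q 5 0 = q 2 0 := s 5 0 2 0 (by omega) (by omega) (by omega) (by omega) (by simp) rfl
  have y0 : q (8 + m) 2 = q 8 2 := step (8 + m) 2 8 2 (by omega) (by omega) (by omega) (by omega)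
    (by simp) (by simp [lab, show ¬ 8 + m < 9 by omega]; omega)
  have y1 : q 8 2 = q 3 2 := s 8 2 3 2 (by omega) (by omega) (by omega) (by omega) (by simp) rfl
  have z0 : ∀ j, j + 1 < m → q (9 + j) 2 = q (10 + j) 0 := fun j hj =>
    step (9 + j) 2 (10 + j) 0 (by omega) (by omega) (by omega) (by omega) (by simp)
      (by simp [lab, show ¬ 10 + j < 9 by omega]; omega)
  have l2 : ∀ j < m, q (9 + j) 3 = q 2 1 := by
    intro j
    induction j with
    | zero => intro hj; exact step 9 3 2 1 (by omega) (by omega) (by omega) (by omega) (by simp)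
                (by simp [lab])
    | succ j ih =>
      intro hj
      rw [← ih (by omega)]
      exact step (9 + (j + 1)) 3 (9 + j) 3 (by omega) (by omega) (by omega) (by omega) (by simp)
        (by simp [lab]; omega)
  have r2 : ∀ j < m, q (9 + j) 1 = q 3 3 := by
    intro j
    induction j with
    | zero =>
      intro hj
      rw [r0, r1]
      exact (step 5 3 9 1 (by omega) (by omega) (by omega) (by omega) (by simp)
                (by simp [lab])).symm
    | succ j ih =>
      intro hj
      rw [← ih (by omega)]
      exact (step (9 + j) 1 (9 + (j + 1)) 1 (by omega) (by omega) (by omega) (by omega) (by simp)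
        (by simp [lab]; omega)).symm
  have hrep : ∀ i k, i < 9 + m → k < 4 → q i k = q (rep (col m i k)).1 (rep (col m i k)).2 := by
    intro i k hi hk
    have hm11 : ¬ 10 + m < 11 := by omega
    have hm2 : 10 + m - 2 = 8 + m := by omega
    by_cases h : i < 9
    · interval_cases i <;> interval_cases k <;>
        simp [col, rep, hm2] <;> simp [*]
    · obtain ⟨j, rfl⟩ : ∃ j, i = 9 + j := ⟨i - 9, by omega⟩
      interval_cases k
      · rcases j with _ | j
        · simp [col, rep, x0, x1]
        · have e : 10 + (j + 1) - 2 = 9 + j := by omega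
          have e' : ¬ 10 + (j + 1) < 11 := by omega
          have e2 : 9 + (j + 1) = 10 + j := by omega
          have h10 := z0 j (by omega)
          rw [← e2] at h10
          simp [col, rep, e, e', h10]
      · simp [col, rep, r2 j (by omega)]
      · have e : 11 + j - 2 = 9 + j := by omega
        simp [col, rep, e]
      · simp [col, rep, l2 j (by omega)]
  have hrep_lt : ∀ c < m + 11, (rep c).1 < 9 + m ∧ (rep c).2 < 4 ∧
      col m (rep c).1 (rep c).2 = c := by
    intro c hc
    by_cases h : c < 11
    · interval_cases c <;> simp [rep, col] <;> omega
    · simp [rep, col, h, show ¬ c - 2 < 9 by omega]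
      omega
  have hbij : Function.Bijective F := by
    constructor
    · intro a b hab
      induction a using Quot.ind with | _ x
      induction b using Quot.ind with | _ y
      obtain ⟨i, k, hi, hk, rfl⟩ := exists_dart p m x
      obtain ⟨j, l, hj, hl, rfl⟩ := exists_dart p m y
      rw [hq, hq] at hab ⊢
      have h := congrArg Fin.val hab
      rw [hF i k hi hk, hF j l hj hl] at h
      rw [hrep i k hi hk, hrep j l hj hl, h]
    · intro c
      obtain ⟨h1, h2, h3⟩ := hrep_lt c.1 c.2
      exact ⟨q (rep c.1).1 (rep c.1).2, Fin.ext (by rw [hF _ _ h1 h2, h3])⟩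
  rw [Nat.card_eq_of_bijective F hbij, Nat.card_eq_fintype_card, Fintype.card_fin]
  ring

theorem isKnotDiagram (p : Bool) (m : ℕ) (hm : Odd m) : (code p m).IsKnotDiagram where
  two_ends := two_ends p m hm.pos
  nonempty := by simp [code, outside]
  one_component := one_component p m hm
  planar := planar p m hm.pos

end TwistFamily

/-- The knot `K n`: there are `|2 n - 1|` half twists in the box, of the first kind when
`2 n - 1` is positive and of the second kind when it is negative. The two strands in the box have
opposite directions. For `0 < n` the diagram is alternating; for `n = 1` it is the (unique, up to
mirror images) reduced alternating diagram of the knot `10_97`. -/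
def K (n : ℤ) : Knot :=
  KnotDiagram.knot ⟨TwistFamily.code (decide (0 < 2 * n - 1)) (2 * n - 1).natAbs,
    TwistFamily.isKnotDiagram _ _ (Int.natAbs_odd.2 ⟨n - 1, by ring⟩)⟩

/-!
The lower bounds come from the Kauffman bracket. It changes only by factors `±A ^ k` under the
Reidemeister moves (`bracket_knot`), so that its span is an invariant of knots. The exponents in the
state sum of a diagram with `c` crossings are bounded by those of the two extreme states, and these
have at most `c + 2` closed curves together (`Code.IsKnotDiagram.loops_add_loops_le`); hence the
span is at most `4 c` (`le_crossingNumber`). The bound on the curves is linear algebra over the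
field with two elements: the number of closed curves of a state is the number of edges minus the
dimension of the span of the vectors `e_a + e_b`, for `a` and `b` joined in the state. The sum of
these spans for the two extreme states is large because the diagram is connected, and their
intersection is large because it contains the vector `e_a + e_b + e_c + e_d` of every crossing.

In a row of half twists, smoothing a crossing either removes it or turns the crossings below into
kinks. Summing the geometric series expresses the brackets of the whole family by the brackets `p`
and `q` of the two diagrams with nine crossings in which the box is filled with two vertical or two
horizontal arcs (`TwistFamily.loopValue_mul_bracket_code`): with `d = -A² - A⁻²`, with an odd number
`m` of half twists, and with `A` inverted in the powers of `A` for the half twists of the second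
kind,

  `d ⟨K⟩ = A ^ (-m) (d p - q) - A ^ (3 m) q`.

The kernel computes `p` and `q`, and the extreme terms on the right show that the span is
`4 (m + 9)` for half twists of the first kind and `4 (m + 6)` for those of the second kind.

The upper bounds are the numbers of crossings of the given diagrams, except for `n = 0`. There the
diagram with ten crossings is reduced by explicit Reidemeister moves to one with seven crossings
(`exists_diagram_seven`). All codes on the way have to be knot diagrams on the sphere, which is
decided by evaluating `Code.Check`.
-/

open Finsupp Module LaurentPolynomial

/-! ### Closed curves of a smoothed diagram -/

/-- The vector `e_a + e_b` over the field with two elements; modulo it, `a` and `b` are identified.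
-/
noncomputable def pairVec (p : ℕ × ℕ) : ℕ →₀ ZMod 2 := single p.1 1 + single p.2 1

/-- The span of the vectors `e_a + e_b` of the pairs `(a, b)` in `L`. Its dimension is the rank of
the graph whose edges are these pairs. -/
noncomputable def pairSpan (L : List (ℕ × ℕ)) : Submodule (ZMod 2) (ℕ →₀ ZMod 2) :=
  Submodule.span _ {v | ∃ p ∈ L, pairVec p = v}

/-- The names which occur in the pairs of `L`. -/
def names (L : List (ℕ × ℕ)) : Finset ℕ := (L.flatMap fun p => [p.1, p.2]).toFinset

/-- The number of components of the graph whose vertices are the names in `L` and whose edges are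
the pairs in `L`. When `L` lists the strands of a diagram without crossings, so that a pair joins
consecutive arcs, the components are the closed curves. The subtraction never truncates, by
`finrank_pairSpan_le`. -/
noncomputable def loops (L : List (ℕ × ℕ)) : ℕ := (names L).card - finrank (ZMod 2) (pairSpan L)

@[simp] theorem names_nil : names [] = ∅ := rfl
@[simp] theorem names_cons (a b : ℕ) (L : List (ℕ × ℕ)) :
    names ((a, b) :: L) = insert a (insert b (names L)) := by
  ext; simp [names]
@[simp] theorem names_append (L M : List (ℕ × ℕ)) : names (L ++ M) = names L ∪ names M := by
  ext; simp [names]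

theorem names_map (f : ℕ → ℕ) (L : List (ℕ × ℕ)) :
    names (L.map (Prod.map f f)) = (names L).image f := by
  induction L with
  | nil => rfl
  | cons p L ih => obtain ⟨a, b⟩ := p; simp [ih, Finset.image_insert]

theorem finite_pairs (L : List (ℕ × ℕ)) : {v | ∃ p ∈ L, pairVec p = v}.Finite := by
  have : {v | ∃ p ∈ L, pairVec p = v} = ((L.map pairVec).toFinset : Set _) := by ext; simp
  rw [this]; exact Finset.finite_toSet _

instance (L : List (ℕ × ℕ)) : FiniteDimensional (ZMod 2) (pairSpan L) :=
  FiniteDimensional.span_of_finite _ (finite_pairs L)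

theorem pairVec_mem_pairSpan {p : ℕ × ℕ} {L : List (ℕ × ℕ)} (h : p ∈ L) : pairVec p ∈ pairSpan L :=
  Submodule.subset_span ⟨p, h, rfl⟩

theorem pairVec_self (a : ℕ) : pairVec (a, a) = 0 := by
  ext x
  simp only [pairVec, Finsupp.add_apply, Finsupp.zero_apply]
  exact CharTwo.add_self_eq_zero _

theorem pairVec_comm (a b : ℕ) : pairVec (a, b) = pairVec (b, a) := add_comm _ _

theorem pairSpan_cons (p : ℕ × ℕ) (L : List (ℕ × ℕ)) :
    pairSpan (p :: L) = Submodule.span _ {pairVec p} ⊔ pairSpan L := by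
  rw [pairSpan, pairSpan, ← Submodule.span_union]
  congr 1
  ext v
  simp [eq_comm]

theorem pairSpan_map (f : ℕ → ℕ) (L : List (ℕ × ℕ)) :
    pairSpan (L.map (Prod.map f f)) =
      (pairSpan L).map (Finsupp.lmapDomain (ZMod 2) (ZMod 2) f) := by
  rw [pairSpan, pairSpan, Submodule.map_span]
  congr 1
  ext v
  simp [pairVec, Finsupp.mapDomain_add, Finsupp.mapDomain_single]

theorem pairSpan_le (L : List (ℕ × ℕ)) :
    pairSpan L ≤
      Submodule.span _ (((names L).image fun x => single x (1 : ZMod 2)) : Finset _) := by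
  refine Submodule.span_le.2 ?_
  rintro v ⟨p, hp, rfl⟩
  refine Submodule.add_mem _ (Submodule.subset_span ?_) (Submodule.subset_span ?_)
  all_goals
    simp only [Finset.coe_image, Set.mem_image, Finset.mem_coe]
    refine ⟨_, ?_, rfl⟩
    simp only [names, List.mem_toFinset, List.mem_flatMap]
    exact ⟨p, hp, by simp⟩

theorem finrank_pairSpan_le (L : List (ℕ × ℕ)) :
    finrank (ZMod 2) (pairSpan L) ≤ (names L).card :=
  (Submodule.finrank_mono (pairSpan_le L)).trans
    ((finrank_span_finset_le_card _).trans Finset.card_image_le)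

/-- Neither the order nor the multiplicity of the pairs matters, nor the order within a pair. -/
theorem loops_congr {L M : List (ℕ × ℕ)} (h : ∀ p, p ∈ L ∨ p.swap ∈ L ↔ p ∈ M ∨ p.swap ∈ M) :
    loops L = loops M := by
  have key : ∀ {L M : List (ℕ × ℕ)}, (∀ p, p ∈ L ∨ p.swap ∈ L → p ∈ M ∨ p.swap ∈ M) →
      pairSpan L ≤ pairSpan M ∧ names L ⊆ names M := by
    intro L M h
    constructor
    · refine Submodule.span_le.2 ?_
      rintro v ⟨⟨a, b⟩, hp, rfl⟩
      rcases h _ (Or.inl hp) with h | h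
      · exact pairVec_mem_pairSpan h
      · rw [pairVec_comm]; exact pairVec_mem_pairSpan h
    · intro x hx
      simp only [names, List.mem_toFinset, List.mem_flatMap] at hx ⊢
      obtain ⟨p, hp, hx⟩ := hx
      rcases h _ (Or.inl hp) with h | h
      · exact ⟨p, h, hx⟩
      · exact ⟨_, h, by simpa [or_comm] using hx⟩
  obtain ⟨h1, h2⟩ := key fun p => (h p).1
  obtain ⟨h3, h4⟩ := key fun p => (h p).2
  rw [loops, loops, le_antisymm h1 h3, Finset.Subset.antisymm h2 h4]

theorem loops_perm {L M : List (ℕ × ℕ)} (h : L.Perm M) : loops L = loops M :=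
  loops_congr fun p => by rw [h.mem_iff, h.mem_iff]

theorem loops_map_injective {f : ℕ → ℕ} (hf : f.Injective) (L : List (ℕ × ℕ)) :
    loops (L.map (Prod.map f f)) = loops L := by
  rw [loops, loops, names_map, Finset.card_image_of_injective _ hf, pairSpan_map,
    ← (Submodule.equivMapOfInjective _ (Finsupp.mapDomain_injective hf) (pairSpan L)).finrank_eq]

/-- The renaming which calls `b` by the name `a`. It is the renaming in `Code.Move.merge`. -/
def mergeName (a b x : ℕ) : ℕ := if x = b then a else x

theorem finrank_pairSpan_cons {a b : ℕ} (hab : a ≠ b) (L : List (ℕ × ℕ)) :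
    finrank (ZMod 2) (pairSpan ((a, b) :: L)) =
      finrank (ZMod 2) (pairSpan (L.map (Prod.map (mergeName a b) (mergeName a b)))) + 1 := by
  set v := pairVec (a, b) with hv
  have hfix : ∀ x, single x (1 : ZMod 2) + single (mergeName a b x) 1 ∈
      Submodule.span (ZMod 2) {v} := by
    intro x
    unfold mergeName
    split_ifs with hx
    · subst hx
      rw [add_comm]
      exact Submodule.mem_span_singleton_self _
    · have := pairVec_self x
      simp only [pairVec] at this
      rw [this]
      exact Submodule.zero_mem _
  have hpair : ∀ p, pairVec p + pairVec (Prod.map (mergeName a b) (mergeName a b) p) ∈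
      Submodule.span (ZMod 2) {v} := by
    rintro ⟨x, y⟩
    have := Submodule.add_mem _ (hfix x) (hfix y)
    rwa [add_add_add_comm] at this
  have hcancel : ∀ u w : ℕ →₀ ZMod 2, u = (u + w) + w := by
    intro u w
    ext x
    simp [add_assoc, CharTwo.add_self_eq_zero]
  set U := pairSpan (L.map (Prod.map (mergeName a b) (mergeName a b))) with hU
  have hsup : pairSpan ((a, b) :: L) = Submodule.span _ {v} ⊔ U := by
    rw [pairSpan_cons]
    apply le_antisymm
    · refine sup_le le_sup_left (Submodule.span_le.2 ?_)
      rintro _ ⟨p, hp, rfl⟩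
      rw [hcancel (pairVec p) (pairVec (Prod.map (mergeName a b) (mergeName a b) p))]
      exact Submodule.add_mem _ (Submodule.mem_sup_left (hpair p)) (Submodule.mem_sup_right
        (pairVec_mem_pairSpan (List.mem_map_of_mem hp)))
    · refine sup_le le_sup_left (Submodule.span_le.2 ?_)
      rintro _ ⟨q, hq, rfl⟩
      obtain ⟨p, hp, rfl⟩ := List.mem_map.1 hq
      rw [hcancel (pairVec (Prod.map _ _ p)) (pairVec p), add_comm (pairVec (Prod.map _ _ p))]
      exact Submodule.add_mem _ (Submodule.mem_sup_left (hpair p)) (Submodule.mem_sup_right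
        (pairVec_mem_pairSpan hp))
  have hb : v b = 1 := by simp [hv, pairVec, hab]
  have hUb : ∀ u ∈ U, u b = 0 := by
    have : U ≤ LinearMap.ker (Finsupp.lapply (R := ZMod 2) (M := ZMod 2) b) := by
      refine Submodule.span_le.2 ?_
      rintro _ ⟨q, hq, rfl⟩
      obtain ⟨⟨x, y⟩, hp, rfl⟩ := List.mem_map.1 hq
      have hs : ∀ x, mergeName a b x ≠ b := by
        intro x
        unfold mergeName
        split_ifs with h
        exacts [hab, h]
      simp [pairVec, hs]
    exact fun u hu => this hu
  -- The coordinate `b` vanishes on `U` but not at `v`.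
  have hinf : Submodule.span (ZMod 2) {v} ⊓ U = ⊥ := by
    rw [Submodule.eq_bot_iff]
    rintro x ⟨hx, hxU⟩
    obtain ⟨c, rfl⟩ := Submodule.mem_span_singleton.1 hx
    have := hUb _ hxU
    rw [Finsupp.smul_apply, hb, smul_eq_mul, mul_one] at this
    rw [this, zero_smul]
  have h := Submodule.finrank_sup_add_finrank_inf_eq (Submodule.span (ZMod 2) {v}) U
  rw [hinf, finrank_bot, ← hsup, finrank_span_singleton (by rintro h0; simp [h0] at hb)] at h
  omega

/-- Contracting an edge keeps the number of components. One end has to occur in `L`: otherwise the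
component `{a, b}` would get lost. -/
theorem loops_merge {a b : ℕ} (hab : a ≠ b) {L : List (ℕ × ℕ)} (h : a ∈ names L ∨ b ∈ names L) :
    loops ((a, b) :: L) = loops (L.map (Prod.map (mergeName a b) (mergeName a b))) := by
  have hc : insert a (insert b (names L)) = insert b ((names L).image (mergeName a b)) := by
    ext x
    simp only [Finset.mem_insert, Finset.mem_image, mergeName]
    constructor
    · rintro (rfl | rfl | hx)
      · rcases h with h | h
        · exact Or.inr ⟨x, h, by simp [hab]⟩
        · exact Or.inr ⟨b, h, by simp⟩
      · exact Or.inl rfl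
      · by_cases hb : x = b
        · exact Or.inl hb
        · exact Or.inr ⟨x, hx, by simp [hb]⟩
    · rintro (rfl | ⟨y, hy, rfl⟩)
      · simp
      · split_ifs <;> simp [hy]
  have hb : b ∉ (names L).image (mergeName a b) := by
    simp only [Finset.mem_image, mergeName, not_exists, not_and]
    intro x _
    split_ifs with h
    · exact hab
    · exact h
  rw [loops, loops, names_cons, hc, Finset.card_insert_of_notMem hb, finrank_pairSpan_cons hab,
    names_map]
  omega

theorem loops_circle {a : ℕ} {L : List (ℕ × ℕ)} (h : a ∉ names L) :
    loops ((a, a) :: L) = loops L + 1 := by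
  have h1 : pairSpan ((a, a) :: L) = pairSpan L := by rw [pairSpan_cons, pairVec_self]; simp
  have := finrank_pairSpan_le L
  rw [loops, loops, h1, names_cons, Finset.insert_idem, Finset.card_insert_of_notMem h]
  omega

/-! ### The Kauffman bracket -/

/-- The value `-A² - A⁻²` of a closed curve in the Kauffman bracket, where `A = T 1`. -/
noncomputable def loopValue : ℤ[T;T⁻¹] := -T 2 - T (-2)

/-- The state sum of `D`, where the arcs in `L` have already been smoothed: each crossing is
replaced by one of the two pairs of arcs, with weights `A` and `A⁻¹`, and a state with `k` closed
curves contributes `loopValue ^ k`. -/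
noncomputable def stateSum : Code → List (ℕ × ℕ) → ℤ[T;T⁻¹]
  | [], L => loopValue ^ loops L
  | .crossing a b c e :: D, L =>
      T 1 * stateSum D ((c, e) :: (a, b) :: L) + T (-1) * stateSum D ((b, c) :: (a, e) :: L)
  | .path a b :: D, L => stateSum D ((a, b) :: L)

/-- The Kauffman bracket, normalized to be `1` at the empty diagram (not at the circle). -/
noncomputable def bracket (D : Code) : ℤ[T;T⁻¹] := stateSum D []

namespace Code

@[simp] theorem edges_nil : edges [] = [] := rfl
@[simp] theorem edges_crossing (a b c e : ℕ) (D : Code) :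
    edges (.crossing a b c e :: D) = a :: b :: c :: e :: edges D := rfl
@[simp] theorem edges_path (a b : ℕ) (D : Code) : edges (.path a b :: D) = a :: b :: edges D := rfl
@[simp] theorem edges_append (D D' : Code) : edges (D ++ D') = edges D ++ edges D' :=
  List.flatMap_append

theorem map_rename_of_fixed {D : Code} {f : ℕ → ℕ} (h : ∀ x ∈ D.edges, f x = x) :
    D.map (Node.rename f) = D := by
  induction D with
  | nil => rfl
  | cons v D ih =>
    rw [List.map_cons, ih fun x hx => h x (List.mem_append_right _ hx)]
    cases v <;> simp_all [Node.rename]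

theorem map_mergeName {D : Code} {a x : ℕ} (h : x ∉ D.edges) :
    D.map (Node.rename (mergeName a x)) = D :=
  map_rename_of_fixed fun y hy => if_neg fun e : y = x => h (e ▸ hy)

end Code

/-- The smoothed arcs only matter through the number of closed curves which they contribute to the
states of `D`, each of which uses all edges of `D`. -/
theorem stateSum_congr (k : ℕ) (D : Code) {L L' : List (ℕ × ℕ)}
    (h : ∀ M, (∀ x, x ∈ names M ↔ x ∈ D.edges) → loops (M ++ L) = loops (M ++ L') + k) :
    stateSum D L = loopValue ^ k * stateSum D L' := by
  induction D generalizing L L' with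
  | nil =>
    have := h [] (by simp)
    simp only [List.nil_append] at this
    rw [stateSum, stateSum, this, pow_add, mul_comm]
  | cons v D ih =>
    cases v with
    | path a b =>
      refine ih fun M hM => ?_
      simpa using h (M ++ [(a, b)]) (by intro x; simp [hM])
    | crossing a b c e =>
      rw [stateSum, stateSum, ih (L' := (c, e) :: (a, b) :: L') fun M hM => ?_,
        ih (L := (b, c) :: (a, e) :: L) (L' := (b, c) :: (a, e) :: L') fun M hM => ?_]
      · ring
      · simpa using h (M ++ [(b, c), (a, e)]) (by intro x; simp [hM]; tauto)
      · simpa using h (M ++ [(c, e), (a, b)]) (by intro x; simp [hM]; tauto)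

theorem stateSum_congr_pairs (D : Code) {L L' : List (ℕ × ℕ)}
    (h : ∀ p, p ∈ L ∨ p.swap ∈ L ↔ p ∈ L' ∨ p.swap ∈ L') : stateSum D L = stateSum D L' := by
  rw [stateSum_congr 0 D fun M _ => ?_, pow_zero, one_mul]
  refine loops_congr fun p => ?_
  have := h p
  simp only [List.mem_append]
  tauto

theorem stateSum_perm_pairs (D : Code) {L L' : List (ℕ × ℕ)} (h : L.Perm L') :
    stateSum D L = stateSum D L' :=
  stateSum_congr_pairs D fun p => by rw [h.mem_iff, h.mem_iff]

theorem stateSum_perm {D D' : Code} (h : D.Perm D') (L : List (ℕ × ℕ)) :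
    stateSum D L = stateSum D' L := by
  induction h generalizing L with
  | nil => rfl
  | cons v _ ih => cases v <;> simp only [stateSum, ih]
  | trans _ _ ih1 ih2 => rw [ih1, ih2]
  | swap v w D =>
    have e : ∀ (P Q R : List (ℕ × ℕ)), stateSum D (P ++ (Q ++ R)) = stateSum D (Q ++ (P ++ R)) := by
      intro P Q R
      refine stateSum_perm_pairs D ?_
      rw [← List.append_assoc, ← List.append_assoc]
      exact (List.perm_append_comm).append_right _
    rcases v with ⟨a, b, c, d⟩ | ⟨a, b⟩ <;> rcases w with ⟨a', b', c', d'⟩ | ⟨a', b'⟩ <;>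
      simp only [stateSum]
    · have e1 := e [(c, d), (a, b)] [(c', d'), (a', b')] L
      have e2 := e [(c, d), (a, b)] [(b', c'), (a', d')] L
      have e3 := e [(b, c), (a, d)] [(c', d'), (a', b')] L
      have e4 := e [(b, c), (a, d)] [(b', c'), (a', d')] L
      simp only [List.cons_append, List.nil_append] at e1 e2 e3 e4
      rw [e1, e2, e3, e4]
      ring
    · have e1 := e [(c, d), (a, b)] [(a', b')] L
      have e2 := e [(b, c), (a, d)] [(a', b')] L
      simp only [List.cons_append, List.nil_append] at e1 e2
      rw [e1, e2]
    · have e1 := e [(a, b)] [(c', d'), (a', b')] L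
      have e2 := e [(a, b)] [(b', c'), (a', d')] L
      simp only [List.cons_append, List.nil_append] at e1 e2
      rw [e1, e2]
    · exact e [(a, b)] [(a', b')] L

theorem stateSum_rename {f : ℕ → ℕ} (hf : f.Injective) (D : Code) (L : List (ℕ × ℕ)) :
    stateSum (D.map (Node.rename f)) (L.map (Prod.map f f)) = stateSum D L := by
  induction D generalizing L with
  | nil => simp only [List.map_nil, stateSum, loops_map_injective hf]
  | cons v D ih => cases v <;> simp only [List.map_cons, Node.rename, stateSum, ← ih, Prod.map]

theorem stateSum_merge {a b : ℕ} (hab : a ≠ b) (D : Code) (L : List (ℕ × ℕ))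
    (h : (a ∈ D.edges ∨ b ∈ D.edges) ∨ a ∈ names L ∨ b ∈ names L) :
    stateSum D (L ++ [(a, b)]) =
      stateSum (D.map (Node.rename (mergeName a b)))
        (L.map (Prod.map (mergeName a b) (mergeName a b))) := by
  induction D generalizing L with
  | nil =>
    simp only [List.map_nil, stateSum]
    rw [loops_perm (M := (a, b) :: L) (by simp),
      loops_merge hab (by simpa using h)]
  | cons v D ih =>
    cases v with
    | path x y =>
      have := ih ((x, y) :: L) (by simp at h ⊢; tauto)
      simpa [stateSum, Node.rename] using this
    | crossing x y z w =>
      have h1 := ih ((z, w) :: (x, y) :: L) (by simp at h ⊢; tauto)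
      have h2 := ih ((y, z) :: (x, w) :: L) (by simp at h ⊢; tauto)
      simp only [List.cons_append] at h1 h2
      simp [stateSum, Node.rename, h1, h2]

theorem bracket_crossing (a b c e : ℕ) (D : Code) :
    bracket (.crossing a b c e :: D) =
      T 1 * bracket (.path a b :: .path c e :: D) +
        T (-1) * bracket (.path a e :: .path b c :: D) := rfl

theorem bracket_perm {D D' : Code} (h : D.Perm D') : bracket D = bracket D' := stateSum_perm h []

theorem bracket_rename {f : ℕ → ℕ} (hf : f.Injective) (D : Code) :
    bracket (D.map (Node.rename f)) = bracket D := stateSum_rename hf D []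

theorem bracket_path_comm (a b : ℕ) (D : Code) :
    bracket (.path a b :: D) = bracket (.path b a :: D) :=
  stateSum_congr_pairs D fun p => by
    obtain ⟨x, y⟩ := p
    simp only [List.mem_singleton, Prod.swap_prod_mk, Prod.mk.injEq]
    tauto

theorem bracket_crossing_turn (a b c e : ℕ) (D : Code) :
    bracket (.crossing a b c e :: D) = bracket (.crossing c e a b :: D) := by
  rw [bracket_crossing, bracket_crossing, bracket_perm (List.Perm.swap (.path c e) (.path a b) D),
    bracket_perm (List.Perm.swap (.path b c) (.path a e) D), bracket_path_comm b c,
    bracket_perm (List.Perm.swap (.path a e) (.path c b) D), bracket_path_comm a e,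
    bracket_perm (List.Perm.swap (.path c b) (.path e a) D)]

theorem bracket_merge {a b : ℕ} (hab : a ≠ b) {D : Code} (h : a ∈ D.edges ∨ b ∈ D.edges) :
    bracket (.path a b :: D) = bracket (D.map (Node.rename (mergeName a b))) :=
  stateSum_merge hab D [] (Or.inl h)

theorem bracket_circle {a : ℕ} {D : Code} (h : a ∉ D.edges) :
    bracket (.path a a :: D) = loopValue * bracket D := by
  have := stateSum_congr 1 D (L := [(a, a)]) (L' := []) fun M hM => ?_
  · rwa [pow_one] at this
  · rw [List.append_nil, loops_perm (M := (a, a) :: M) (by simp)]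
    exact loops_circle (by rwa [hM])

theorem bracket_join {a x b : ℕ} {D : Code} (hxa : x ≠ a) (hxb : x ≠ b) (hx : x ∉ D.edges) :
    bracket (.path a x :: .path x b :: D) = bracket (.path a b :: D) := by
  rw [bracket_merge hxa.symm (Or.inr (by simp)), List.map_cons, Code.map_mergeName hx]
  simp [Node.rename, mergeName, hxb.symm]

/-- The bracket of a kink: `A (-A² - A⁻²) + A⁻¹ = -A³`. -/
theorem bracket_kink {x a b : ℕ} {D : Code} (hxa : x ≠ a) (hxb : x ≠ b) (hx : x ∉ D.edges) :
    bracket (.crossing x x a b :: D) = -T 3 * bracket (.path a b :: D) := by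
  rw [bracket_crossing, bracket_circle (by simp [hxa, hxb, hx]), bracket_path_comm x b,
    bracket_join hxb hxa hx, bracket_path_comm b a, ← mul_assoc, ← add_mul, loopValue]
  congr 1
  simp only [mul_sub, mul_neg, ← T_add]
  norm_num

/-- The bracket of a kink of the other kind: `A + A⁻¹ (-A² - A⁻²) = -A⁻³`. -/
theorem bracket_kink' {x a b : ℕ} {D : Code} (hxa : x ≠ a) (hxb : x ≠ b) (hx : x ∉ D.edges) :
    bracket (.crossing a x x b :: D) = -T (-3) * bracket (.path a b :: D) := by
  rw [bracket_crossing, bracket_join hxa hxb hx, bracket_perm (List.Perm.swap _ _ _),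
    bracket_circle (by simp [hxa, hxb, hx]), ← mul_assoc, ← add_mul, loopValue]
  congr 1
  simp only [mul_sub, mul_neg, ← T_add]
  norm_num
  abel

/-- Invariance under the second Reidemeister move. Smoothing the first crossing leaves either a
single crossing or a kink, and the terms in which `a`, `c` are joined cancel. -/
theorem bracket_bigon {a b c e x y : ℕ} {D : Code} (hxy : x ≠ y)
    (hx : x ∉ [a, b, c, e]) (hy : y ∉ [a, b, c, e]) (hxD : x ∉ D.edges) (hyD : y ∉ D.edges) :
    bracket (.crossing c x y a :: .crossing y x e b :: D) =
      bracket (.path a b :: .path c e :: D) := by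
  simp only [List.mem_cons, List.not_mem_nil, or_false, not_or] at hx hy
  obtain ⟨xa, xb, xc, xe⟩ := hx
  obtain ⟨ya, yb, yc, ye⟩ := hy
  rw [bracket_crossing]
  have h1 : bracket (.path c x :: .path y a :: .crossing y x e b :: D) =
      bracket (.crossing a c e b :: D) := by
    rw [bracket_merge (Ne.symm xc) (Or.inr (by simp)), List.map_cons, List.map_cons,
      Code.map_mergeName hxD]
    simp only [Node.rename, mergeName, if_neg hxy.symm, if_neg (Ne.symm xa), if_neg (Ne.symm xe),
      if_neg (Ne.symm xb), if_true]
    rw [bracket_path_comm, bracket_merge (Ne.symm ya) (Or.inr (by simp)), List.map_cons,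
      Code.map_mergeName hyD]
    simp only [Node.rename, mergeName, if_neg (Ne.symm yc), if_neg (Ne.symm ye),
      if_neg (Ne.symm yb), if_true]
  have h2 : bracket (.path c a :: .path x y :: .crossing y x e b :: D) =
      -T 3 * bracket (.path e b :: .path c a :: D) := by
    rw [bracket_perm (List.Perm.swap _ _ _),
      bracket_merge hxy (Or.inr (by simp)), List.map_cons, List.map_cons, Code.map_mergeName hyD]
    simp only [Node.rename, mergeName, if_neg (Ne.symm yc), if_neg (Ne.symm ya),
      if_neg (Ne.symm ye),
      if_neg (Ne.symm yb), if_true, if_neg hxy]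
    rw [bracket_perm (List.Perm.swap _ _ _), bracket_kink xe xb (by simp [*])]
  have h3 : bracket (.path e b :: .path c a :: D) = bracket (.path a c :: .path e b :: D) := by
    rw [bracket_perm (List.Perm.swap _ _ _), bracket_path_comm]
  rw [h1, h2, h3, bracket_crossing, bracket_perm (List.Perm.swap (.path c e) (.path a b) D)]
  simp only [mul_add, ← mul_assoc, mul_neg, ← T_add]
  norm_num

/-! ### Invariance under the Reidemeister moves -/

section Triangle

variable {p0 p1 p2 p3 p4 p5 x y z : ℕ} {D : Code}

/-- One smoothing of the crossing of the two lower strands: the top strand still crosses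
both arcs. -/
theorem bracket_triangle_join (hxy : x ≠ y) (hxz : x ≠ z) (hyz : y ≠ z)
    (hy : y ∉ [p0, p1, p2, p3, p4, p5]) (hz : z ∉ [p0, p1, p2, p3, p4, p5])
    (hyD : y ∉ D.edges) (hzD : z ∉ D.edges) :
    bracket (.path p5 y :: .path z p4 :: .crossing p1 x y p0 :: .crossing p2 p3 z x :: D) =
      bracket (.crossing p1 x p5 p0 :: .crossing p2 p3 p4 x :: D) := by
  simp only [List.mem_cons, List.not_mem_nil, or_false, not_or] at hy hz
  obtain ⟨y0, y1, y2, y3, y4, y5⟩ := hy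
  obtain ⟨z0, z1, z2, z3, z4, z5⟩ := hz
  rw [bracket_merge (Ne.symm y5) (Or.inr (by simp)), List.map_cons, List.map_cons, List.map_cons,
    Code.map_mergeName hyD]
  simp only [Node.rename, mergeName, if_neg hxy, if_neg (Ne.symm y0), if_neg (Ne.symm y1),
    if_neg (Ne.symm y2), if_neg (Ne.symm y3), if_neg (Ne.symm y4), if_neg hyz.symm, if_true]
  rw [bracket_path_comm, bracket_merge (Ne.symm z4) (Or.inr (by simp)), List.map_cons,
    List.map_cons, Code.map_mergeName hzD]
  simp only [Node.rename, mergeName, if_neg hxz, if_neg (Ne.symm z0), if_neg (Ne.symm z1),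
    if_neg (Ne.symm z2), if_neg (Ne.symm z3), if_neg (Ne.symm z5), if_true]

/-- The other smoothing of the crossing of the two lower strands: the top strand can be pulled off
by a second Reidemeister move. -/
theorem bracket_triangle_bigon (hxy : x ≠ y) (hxz : x ≠ z) (hyz : y ≠ z)
    (hx : x ∉ [p0, p1, p2, p3, p4, p5]) (hy : y ∉ [p0, p1, p2, p3, p4, p5])
    (hz : z ∉ [p0, p1, p2, p3, p4, p5])
    (hxD : x ∉ D.edges) (hyD : y ∉ D.edges) (hzD : z ∉ D.edges) :
    bracket (.path p5 p4 :: .path y z :: .crossing p1 x y p0 :: .crossing p2 p3 z x :: D) =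
      bracket (.path p0 p3 :: .path p1 p2 :: .path p4 p5 :: D) := by
  simp only [List.mem_cons, List.not_mem_nil, or_false, not_or] at hx hy hz
  obtain ⟨x0, x1, x2, x3, x4, x5⟩ := hx
  obtain ⟨y0, y1, y2, y3, y4, y5⟩ := hy
  obtain ⟨z0, z1, z2, z3, z4, z5⟩ := hz
  rw [bracket_path_comm, bracket_perm (List.Perm.swap _ _ _),
    bracket_merge hyz (Or.inr (by simp)), List.map_cons, List.map_cons, List.map_cons,
    Code.map_mergeName hzD]
  simp only [Node.rename, mergeName, if_neg hxz, if_neg (Ne.symm z0), if_neg (Ne.symm z1),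
    if_neg (Ne.symm z2), if_neg (Ne.symm z3), if_neg (Ne.symm z4), if_neg (Ne.symm z5),
    if_neg hyz, if_true]
  have e1 : List.Perm (.path p4 p5 :: .crossing p1 x y p0 :: .crossing p2 p3 y x :: D)
      (.crossing p2 p3 y x :: .crossing p1 x y p0 :: .path p4 p5 :: D) :=
    List.perm_iff_count.2 fun v => by simp only [List.count_cons]; ring
  rw [bracket_perm e1, bracket_crossing_turn, bracket_perm (List.Perm.swap _ _ _),
    bracket_bigon hxy (by simp [*]) (by simp [*]) (by simp [*]) (by simp [*])]

/-- Kauffman's computation for the third Reidemeister move. Half a turn of the triangle replaces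
`p_i` by `p_(i+3)` and `x, y, z` by `z, x, y`; it turns one side of the move into the other, and
both terms on the right are invariant by `bracket_two_crossings` and `bracket_three_paths`. -/
theorem bracket_triangle (hxy : x ≠ y) (hxz : x ≠ z) (hyz : y ≠ z)
    (hx : x ∉ [p0, p1, p2, p3, p4, p5]) (hy : y ∉ [p0, p1, p2, p3, p4, p5])
    (hz : z ∉ [p0, p1, p2, p3, p4, p5])
    (hxD : x ∉ D.edges) (hyD : y ∉ D.edges) (hzD : z ∉ D.edges) :
    bracket (.crossing p1 x y p0 :: .crossing p2 p3 z x :: .crossing p5 y z p4 :: D) =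
      T 1 * bracket (.crossing p1 x p5 p0 :: .crossing p2 p3 p4 x :: D) +
        T (-1) * bracket (.path p0 p3 :: .path p1 p2 :: .path p4 p5 :: D) := by
  have e : List.Perm (.crossing p1 x y p0 :: .crossing p2 p3 z x :: .crossing p5 y z p4 :: D)
      (.crossing p5 y z p4 :: .crossing p1 x y p0 :: .crossing p2 p3 z x :: D) :=
    List.perm_middle (l₁ := [_, _])
  rw [bracket_perm e, bracket_crossing,
    bracket_triangle_join hxy hxz hyz hy hz hyD hzD,
    bracket_triangle_bigon hxy hxz hyz hx hy hz hxD hyD hzD]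

/-- The analogue of `bracket_triangle` when the two lower strands cross the other way. -/
theorem bracket_triangle' (hxy : x ≠ y) (hxz : x ≠ z) (hyz : y ≠ z)
    (hx : x ∉ [p0, p1, p2, p3, p4, p5]) (hy : y ∉ [p0, p1, p2, p3, p4, p5])
    (hz : z ∉ [p0, p1, p2, p3, p4, p5])
    (hxD : x ∉ D.edges) (hyD : y ∉ D.edges) (hzD : z ∉ D.edges) :
    bracket (.crossing p1 x y p0 :: .crossing p2 p3 z x :: .crossing p4 p5 y z :: D) =
      T 1 * bracket (.path p0 p3 :: .path p1 p2 :: .path p4 p5 :: D) +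
        T (-1) * bracket (.crossing p1 x p5 p0 :: .crossing p2 p3 p4 x :: D) := by
  have e : List.Perm (.crossing p1 x y p0 :: .crossing p2 p3 z x :: .crossing p4 p5 y z :: D)
      (.crossing p4 p5 y z :: .crossing p1 x y p0 :: .crossing p2 p3 z x :: D) :=
    List.perm_middle (l₁ := [_, _])
  rw [bracket_perm e, bracket_crossing, bracket_path_comm p4 p5,
    bracket_triangle_bigon hxy hxz hyz hx hy hz hxD hyD hzD, bracket_path_comm p4 z,
    bracket_perm (List.Perm.swap (.path p5 y) (.path z p4) _),
    bracket_triangle_join hxy hxz hyz hy hz hyD hzD]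

theorem bracket_three_paths :
    bracket (.path p3 p0 :: .path p4 p5 :: .path p1 p2 :: D) =
      bracket (.path p0 p3 :: .path p1 p2 :: .path p4 p5 :: D) := by
  rw [bracket_path_comm, bracket_perm ((List.Perm.swap (.path p1 p2) (.path p4 p5) D).cons _)]

theorem bracket_two_crossings (hx : x ∉ [p0, p1, p2, p3, p4, p5])
    (hz : z ∉ [p0, p1, p2, p3, p4, p5]) (hxD : x ∉ D.edges) (hzD : z ∉ D.edges) :
    bracket (.crossing p4 z p2 p3 :: .crossing p5 p0 p1 z :: D) =
      bracket (.crossing p1 x p5 p0 :: .crossing p2 p3 p4 x :: D) := by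
  simp only [List.mem_cons, List.not_mem_nil, or_false, not_or] at hx hz
  obtain ⟨x0, x1, x2, x3, x4, x5⟩ := hx
  obtain ⟨z0, z1, z2, z3, z4, z5⟩ := hz
  have hf : ∀ {a}, x ≠ a → z ≠ a → Equiv.swap x z a = a := fun h h' =>
    Equiv.swap_apply_of_ne_of_ne h.symm h'.symm
  rw [← bracket_rename (Equiv.swap x z).injective (.crossing p1 x p5 p0 :: _), List.map_cons,
    List.map_cons, Code.map_rename_of_fixed fun y hy => hf (fun h => hxD (h ▸ hy))
      (fun h => hzD (h ▸ hy))]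
  simp only [Node.rename, Equiv.swap_apply_left, hf x0 z0, hf x1 z1, hf x2 z2, hf x3 z3, hf x4 z4,
    hf x5 z5]
  rw [bracket_crossing_turn p4, bracket_perm (List.Perm.swap _ _ _), bracket_crossing_turn p5]

end Triangle

/-- Equality of Laurent polynomials up to a factor `±T ^ k`. -/
def UnitEquiv (p q : ℤ[T;T⁻¹]) : Prop := ∃ k : ℤ, p = T k * q ∨ p = -T k * q

namespace UnitEquiv

theorem of_eq {p q : ℤ[T;T⁻¹]} (h : p = q) : UnitEquiv p q := ⟨0, Or.inl (by simp [h])⟩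

theorem symm {p q : ℤ[T;T⁻¹]} (h : UnitEquiv p q) : UnitEquiv q p := by
  obtain ⟨k, rfl | rfl⟩ := h <;> refine ⟨-k, ?_⟩ <;> simp [← mul_assoc]

theorem trans {p q r : ℤ[T;T⁻¹]} (h : UnitEquiv p q) (h' : UnitEquiv q r) : UnitEquiv p r := by
  obtain ⟨k, rfl | rfl⟩ := h <;> obtain ⟨l, rfl | rfl⟩ := h' <;> refine ⟨k + l, ?_⟩ <;>
    simp [← mul_assoc]

end UnitEquiv

/-- An edge with two ends among the given ones occurs nowhere else. -/
theorem Code.IsKnotDiagram.fresh {D : Code} (h : D.IsKnotDiagram) {x : ℕ} {L : List ℕ}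
    (hL : D.edges.Perm (x :: x :: L)) : x ∉ L := by
  have := h.two_ends x (hL.mem_iff.2 (by simp))
  rw [hL.count_eq, List.count_cons_self, List.count_cons_self] at this
  exact List.count_eq_zero.1 (by omega)

theorem bracket_move {D D' : Code} (h : Code.Move D D') (hD : D.IsKnotDiagram)
    (hD' : D'.IsKnotDiagram) : UnitEquiv (bracket D) (bracket D') := by
  cases h with
  | reorder _ _ h => exact .of_eq (bracket_perm h)
  | rename _ f hf => exact .of_eq (bracket_rename hf _).symm
  | turn a b c d D => exact .of_eq (bracket_crossing_turn a b c d D)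
  | turnPath a b D => exact .of_eq (bracket_path_comm a b D)
  | merge a b D hab =>
    refine .of_eq (bracket_merge hab (Or.inl ?_))
    have := hD.two_ends a (by simp)
    rw [Code.edges_path, List.count_cons_self, List.count_cons_of_ne hab.symm] at this
    exact List.count_pos_iff.1 (by omega)
  | r1 x a b D =>
    have h0 := hD.fresh (x := x) (L := a :: b :: Code.edges D) (.refl _)
    simp only [List.mem_cons, not_or] at h0
    exact ⟨3, Or.inr (bracket_kink h0.1 h0.2.1 h0.2.2)⟩
  | r1' x a b D =>
    have h0 := hD.fresh (x := x) (L := a :: b :: Code.edges D) (List.perm_iff_count.2 fun v => by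
      simp only [Code.edges_crossing, List.count_cons]; ring)
    simp only [List.mem_cons, not_or] at h0
    exact ⟨-3, Or.inr (bracket_kink' h0.1 h0.2.1 h0.2.2)⟩
  | r2 a b c d x y D =>
    have hx := hD.fresh (x := x) (L := y :: y :: [a, b, c, d] ++ Code.edges D)
      (List.perm_iff_count.2 fun v => by
        simp only [Code.edges_crossing, List.count_cons, List.cons_append, List.nil_append]; ring)
    have hy := hD.fresh (x := y) (L := x :: x :: [a, b, c, d] ++ Code.edges D)
      (List.perm_iff_count.2 fun v => by
        simp only [Code.edges_crossing, List.count_cons, List.cons_append, List.nil_append]; ring)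
    simp only [List.cons_append, List.mem_cons, List.nil_append, not_or] at hx hy
    exact .of_eq (bracket_bigon hx.1 (by simp [hx]) (by simp [hy]) (by simp [hx]) (by simp [hy]))
  | r3 p0 p1 p2 p3 p4 p5 x y z D =>
    have hx := hD.fresh (x := x) (L := y :: y :: z :: z :: [p0, p1, p2, p3, p4, p5] ++ Code.edges D)
      (List.perm_iff_count.2 fun v => by
        simp only [Code.edges_crossing, List.count_cons, List.cons_append, List.nil_append]; ring)
    have hy := hD.fresh (x := y) (L := x :: x :: z :: z :: [p0, p1, p2, p3, p4, p5] ++ Code.edges D)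
      (List.perm_iff_count.2 fun v => by
        simp only [Code.edges_crossing, List.count_cons, List.cons_append, List.nil_append]; ring)
    have hz := hD.fresh (x := z) (L := x :: x :: y :: y :: [p0, p1, p2, p3, p4, p5] ++ Code.edges D)
      (List.perm_iff_count.2 fun v => by
        simp only [Code.edges_crossing, List.count_cons, List.cons_append, List.nil_append]; ring)
    simp only [List.cons_append, List.mem_cons, List.nil_append, not_or] at hx hy hz
    have e : List.Perm (.crossing p2 x y p1 :: .crossing p4 z x p3 :: .crossing p5 p0 y z :: D)
      (.crossing p4 z x p3 :: .crossing p5 p0 y z :: .crossing p2 x y p1 :: D) :=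
      (List.perm_middle (l₁ := [_, _])).symm
    refine .of_eq ?_
    rw [bracket_perm e, bracket_triangle, bracket_triangle, bracket_three_paths,
      bracket_two_crossings (p0 := p0) (p1 := p1) (x := x) (z := z)] <;> simp [*, Ne.symm]
  | r3' p0 p1 p2 p3 p4 p5 x y z D =>
    have hx := hD.fresh (x := x) (L := y :: y :: z :: z :: [p0, p1, p2, p3, p4, p5] ++ Code.edges D)
      (List.perm_iff_count.2 fun v => by
        simp only [Code.edges_crossing, List.count_cons, List.cons_append, List.nil_append]; ring)
    have hy := hD.fresh (x := y) (L := x :: x :: z :: z :: [p0, p1, p2, p3, p4, p5] ++ Code.edges D)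
      (List.perm_iff_count.2 fun v => by
        simp only [Code.edges_crossing, List.count_cons, List.cons_append, List.nil_append]; ring)
    have hz := hD.fresh (x := z) (L := x :: x :: y :: y :: [p0, p1, p2, p3, p4, p5] ++ Code.edges D)
      (List.perm_iff_count.2 fun v => by
        simp only [Code.edges_crossing, List.count_cons, List.cons_append, List.nil_append]; ring)
    simp only [List.cons_append, List.mem_cons, List.nil_append, not_or] at hx hy hz
    have e : List.Perm (.crossing p1 p2 x y :: .crossing p4 z x p3 :: .crossing p5 p0 y z :: D)
      (.crossing p4 z x p3 :: .crossing p5 p0 y z :: .crossing p1 p2 x y :: D) :=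
      (List.perm_middle (l₁ := [_, _])).symm
    refine .of_eq ?_
    rw [bracket_perm e, bracket_triangle', bracket_triangle', bracket_three_paths,
      bracket_two_crossings (p0 := p0) (p1 := p1) (x := x) (z := z)] <;> simp [*, Ne.symm]

/-- Up to a factor `±T ^ k`, the bracket is an invariant of knots. -/
theorem bracket_knot {D D' : KnotDiagram} (h : D.knot = D'.knot) :
    UnitEquiv (bracket D.1) (bracket D'.1) := by
  replace h : Relation.EqvGen (fun D D' : KnotDiagram => Code.Move D.1 D'.1) D D' :=
    Quotient.exact h
  induction h with
  | rel D D' h => exact bracket_move h D.2 D'.2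
  | refl D => exact .of_eq rfl
  | symm _ _ _ ih => exact ih.symm
  | trans _ _ _ _ _ ih1 ih2 => exact ih1.trans ih2

/-! ### The span of the bracket and the number of crossings -/

theorem coeff_T_mul (n k : ℤ) (p : ℤ[T;T⁻¹]) : (T n * p).coeff k = p.coeff (k - n) := by
  rw [T, AddMonoidAlgebra.coeff_single_mul_eq_mul_coeff (k - n), one_mul]
  intro m _
  omega

/-- All exponents of `p` lie between `l` and `u`. -/
def SupportedIn (p : ℤ[T;T⁻¹]) (l u : ℤ) : Prop := ∀ k, p.coeff k ≠ 0 → l ≤ k ∧ k ≤ u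

namespace SupportedIn

variable {p q : ℤ[T;T⁻¹]} {l u : ℤ}

theorem mono (h : SupportedIn p l u) {l' u' : ℤ} (hl : l' ≤ l) (hu : u ≤ u') :
    SupportedIn p l' u' := fun k hk => ⟨hl.trans (h k hk).1, (h k hk).2.trans hu⟩

theorem add (hp : SupportedIn p l u) (hq : SupportedIn q l u) : SupportedIn (p + q) l u := by
  intro k hk
  by_cases h : p.coeff k = 0
  · exact hq k fun h' => hk (by simp [h, h'])
  · exact hp k h

theorem neg (hp : SupportedIn p l u) : SupportedIn (-p) l u := fun k hk =>
  hp k fun h => hk (by simp [h])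

theorem T_mul (hp : SupportedIn p l u) (n : ℤ) : SupportedIn (T n * p) (n + l) (n + u) := by
  intro k hk
  rw [coeff_T_mul] at hk
  have := hp _ hk
  omega

theorem loopValue_mul (hp : SupportedIn p l u) : SupportedIn (loopValue * p) (l - 2) (u + 2) := by
  have e : loopValue * p = -(T 2 * p) + -(T (-2) * p) := by rw [loopValue]; ring
  rw [e]
  exact ((hp.T_mul 2).neg.mono (by omega) (by omega)).add
    ((hp.T_mul (-2)).neg.mono (by omega) (by omega))

theorem loopValue_pow (n : ℕ) : SupportedIn (loopValue ^ n) (-2 * n) (2 * n) := by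
  induction n with
  | zero =>
    intro k hk
    rw [pow_zero, ← T_zero, T_apply] at hk
    by_contra h
    refine hk (if_neg fun h0 => h ?_)
    subst h0
    simp
  | succ n ih =>
    rw [pow_succ']
    exact ih.loopValue_mul.mono (by push_cast; omega) (by push_cast; omega)

theorem of_unitEquiv (h : UnitEquiv q p) (hp : SupportedIn p l u) :
    ∃ k, SupportedIn q (k + l) (k + u) := by
  obtain ⟨k, rfl | rfl⟩ := h
  · exact ⟨k, hp.T_mul k⟩
  · exact ⟨k, by rw [neg_mul]; exact (hp.T_mul k).neg⟩

end SupportedIn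

namespace Code

/-- The arcs of the state in which all crossings are smoothed with weight `A`. -/
def stateA : Code → List (ℕ × ℕ)
  | [] => []
  | .crossing a b c e :: D => (c, e) :: (a, b) :: stateA D
  | .path a b :: D => (a, b) :: stateA D

/-- The arcs of the state in which all crossings are smoothed with weight `A⁻¹`. -/
def stateB : Code → List (ℕ × ℕ)
  | [] => []
  | .crossing a b c e :: D => (b, c) :: (a, e) :: stateB D
  | .path a b :: D => (a, b) :: stateB D

theorem crossings_crossing (a b c e : ℕ) (D : Code) :
    crossings (.crossing a b c e :: D) = crossings D + 1 :=
  List.countP_cons_of_pos rfl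

theorem crossings_path (a b : ℕ) (D : Code) : crossings (.path a b :: D) = crossings D :=
  List.countP_cons_of_neg (by simp [Node.isCrossing])

end Code

/-- Changing the smoothing of one crossing changes the number of closed curves by at most one: the
two spans differ by `e_a + e_b`, as `e_a + e_b + e_c + e_e` lies in both. -/
theorem loops_switch_le (a b c e : ℕ) (L : List (ℕ × ℕ)) :
    loops ((b, c) :: (a, e) :: L) ≤ loops ((c, e) :: (a, b) :: L) + 1 := by
  have hn : names ((b, c) :: (a, e) :: L) = names ((c, e) :: (a, b) :: L) := by
    ext x; simp; tauto
  have hle : pairSpan ((c, e) :: (a, b) :: L) ≤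
      Submodule.span (ZMod 2) {pairVec (a, b)} ⊔ pairSpan ((b, c) :: (a, e) :: L) := by
    have h1 : pairVec (a, b) ∈
        Submodule.span (ZMod 2) {pairVec (a, b)} ⊔ pairSpan ((b, c) :: (a, e) :: L) :=
      Submodule.mem_sup_left (Submodule.mem_span_singleton_self _)
    have h2 : ∀ p ∈ (b, c) :: (a, e) :: L, pairVec p ∈
        Submodule.span (ZMod 2) {pairVec (a, b)} ⊔ pairSpan ((b, c) :: (a, e) :: L) :=
      fun p hp => Submodule.mem_sup_right (pairVec_mem_pairSpan hp)
    refine Submodule.span_le.2 ?_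
    rintro _ ⟨p, hp, rfl⟩
    rcases List.mem_cons.1 hp with rfl | hp
    · have : pairVec (c, e) = pairVec (a, b) + pairVec (b, c) + pairVec (a, e) := by
        ext x
        simp only [pairVec, Finsupp.add_apply]
        linear_combination (-(single a (1 : ZMod 2)) x - (single b 1) x) *
          (CharTwo.two_eq_zero (R := ZMod 2))
      rw [this]
      exact add_mem (add_mem h1 (h2 _ (by simp))) (h2 _ (by simp))
    rcases List.mem_cons.1 hp with rfl | hp
    · exact h1
    · exact h2 p (by simp [hp])
  have hr := (Submodule.finrank_mono hle).trans (Submodule.finrank_add_le_finrank_add_finrank _ _)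
  have h1 : finrank (ZMod 2) (Submodule.span (ZMod 2) {pairVec (a, b)}) ≤ 1 := by
    simpa using finrank_span_le_card (R := ZMod 2) {pairVec (a, b)}
  rw [loops, loops, hn]
  omega

theorem loops_switch_le' (a b c e : ℕ) (L : List (ℕ × ℕ)) :
    loops ((c, e) :: (a, b) :: L) ≤ loops ((b, c) :: (a, e) :: L) + 1 := by
  have := loops_switch_le b c e a L
  have e1 : loops ((e, a) :: (b, c) :: L) = loops ((b, c) :: (a, e) :: L) :=
    loops_congr fun p => by obtain ⟨x, y⟩ := p; simp; tauto
  have e2 : loops ((c, e) :: (b, a) :: L) = loops ((c, e) :: (a, b) :: L) :=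
    loops_congr fun p => by obtain ⟨x, y⟩ := p; simp; tauto
  omega

/-- The exponents of a state lie in the range given by the two extreme states, since every switch of
a smoothing changes the weight by two and the number of closed curves by at most one. -/
theorem stateSum_supportedIn (D : Code) (L : List (ℕ × ℕ)) :
    SupportedIn (stateSum D L) (-(D.crossings + 2 * loops (Code.stateB D ++ L)))
      (D.crossings + 2 * loops (Code.stateA D ++ L)) := by
  induction D generalizing L with
  | nil =>
    refine (SupportedIn.loopValue_pow (loops L)).mono ?_ ?_ <;>
      simp [Code.crossings, Code.stateA, Code.stateB]
  | cons v D ih =>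
    cases v with
    | path a b =>
      have := ih ((a, b) :: L)
      rwa [loops_perm (List.perm_middle (l₁ := Code.stateA D)),
        loops_perm (List.perm_middle (l₁ := Code.stateB D))] at this
    | crossing a b c e =>
      have hp : ∀ (M : List (ℕ × ℕ)) (p q : ℕ × ℕ),
          loops (M ++ p :: q :: L) = loops (p :: q :: (M ++ L)) := fun M p q =>
        loops_perm (List.perm_middle.trans (List.perm_middle.cons _))
      have hA := ih ((c, e) :: (a, b) :: L)
      have hB := ih ((b, c) :: (a, e) :: L)
      rw [hp, hp] at hA hB
      rw [Code.crossings_crossing, stateSum, Code.stateA, Code.stateB]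
      have h1 := loops_switch_le a b c e (Code.stateA D ++ L)
      have h2 := loops_switch_le' a b c e (Code.stateB D ++ L)
      simp only [List.cons_append]
      refine ((hA.T_mul 1).mono ?_ ?_).add ((hB.T_mul (-1)).mono ?_ ?_) <;> push_cast <;> omega

namespace Code

theorem names_stateA (D : Code) : names (Code.stateA D) = D.edges.toFinset := by
  induction D with
  | nil => rfl
  | cons v D ih =>
    cases v with
    | crossing a b c e => ext x; simp [stateA, ih]; tauto
    | path a b => ext x; simp [stateA, ih]

theorem names_stateB (D : Code) : names (Code.stateB D) = D.edges.toFinset := by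
  induction D with
  | nil => rfl
  | cons v D ih =>
    cases v with
    | crossing a b c e => ext x; simp [stateB, ih]; tauto
    | path a b => ext x; simp [stateB, ih]

theorem length_edges (D : Code) : D.edges.length = 2 * D.length + 2 * D.crossings := by
  induction D with
  | nil => rfl
  | cons v D ih =>
    cases v <;> simp only [edges_crossing, edges_path, crossings_crossing, crossings_path,
      List.length_cons, ih] <;> ring

theorem IsKnotDiagram.card_edges {D : Code} (h : D.IsKnotDiagram) :
    D.edges.toFinset.card = D.length + D.crossings := by
  have h1 := List.sum_toFinset_count_eq_length D.edges
  rw [Finset.sum_congr rfl fun a ha => h.two_ends a (List.mem_toFinset.1 ha), Finset.sum_const,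
    length_edges, smul_eq_mul] at h1
  omega

/-- The sum of the basis vectors of the edges at a vertex, counted once for each end. -/
noncomputable def vertexVec (v : Node) : ℕ →₀ ZMod 2 := (v.edges.map fun a => single a 1).sum

/-- In both smoothings the four ends at a crossing are joined in pairs. -/
theorem vertexVec_mem {D : Code} {v : Node} (h : v ∈ D) :
    vertexVec v ∈ pairSpan (stateA D) ⊓ pairSpan (stateB D) := by
  induction D with
  | nil => simp at h
  | cons w D ih =>
    have hA : pairSpan (stateA D) ≤ pairSpan (stateA (w :: D)) := by
      cases w <;> simp only [stateA, pairSpan_cons]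
      · exact le_sup_right.trans le_sup_right
      · exact le_sup_right
    have hB : pairSpan (stateB D) ≤ pairSpan (stateB (w :: D)) := by
      cases w <;> simp only [stateB, pairSpan_cons]
      · exact le_sup_right.trans le_sup_right
      · exact le_sup_right
    rcases List.mem_cons.1 h with rfl | h
    · rcases v with ⟨a, b, c, e⟩ | ⟨a, b⟩
      · constructor
        · have : vertexVec (.crossing a b c e) = pairVec (a, b) + pairVec (c, e) := by
            simp [vertexVec, Node.edges, pairVec, add_assoc]
          rw [this]
          exact add_mem (pairVec_mem_pairSpan (by simp [stateA]))
            (pairVec_mem_pairSpan (by simp [stateA]))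
        · have : vertexVec (.crossing a b c e) = pairVec (a, e) + pairVec (b, c) := by
            simp [vertexVec, Node.edges, pairVec]
            abel
          rw [this]
          exact add_mem (pairVec_mem_pairSpan (by simp [stateB]))
            (pairVec_mem_pairSpan (by simp [stateB]))
      · have : vertexVec (.path a b) = pairVec (a, b) := by
          simp [vertexVec, Node.edges, pairVec]
        rw [this]
        exact ⟨pairVec_mem_pairSpan (by simp [stateA]), pairVec_mem_pairSpan (by simp [stateB])⟩
    · exact ⟨hA (ih h).1, hB (ih h).2⟩

theorem pairVec_trans (a b c : ℕ) : pairVec (a, c) = pairVec (a, b) + pairVec (b, c) := by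
  ext x
  simp only [pairVec, Finsupp.add_apply]
  linear_combination (-(single b (1 : ZMod 2)) x) * (CharTwo.two_eq_zero (R := ZMod 2))

theorem pairVec_mem_of_passes {D : Code} {x y : ℕ} {v : Node} (hv : v ∈ D) (h : v.Passes x y) :
    pairVec (x, y) ∈ pairSpan (stateA D) ⊔ pairSpan (stateB D) := by
  induction D with
  | nil => simp at hv
  | cons w D ih =>
    have hle : pairSpan (stateA D) ⊔ pairSpan (stateB D) ≤
        pairSpan (stateA (w :: D)) ⊔ pairSpan (stateB (w :: D)) := by
      cases w <;> simp only [stateA, stateB, pairSpan_cons]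
      · exact sup_le_sup (le_sup_right.trans le_sup_right) (le_sup_right.trans le_sup_right)
      · exact sup_le_sup le_sup_right le_sup_right
    rcases List.mem_cons.1 hv with rfl | hv
    · rcases v with ⟨a, b, c, e⟩ | ⟨a, b⟩
      · have hab : pairVec (a, b) ∈ pairSpan (stateA (.crossing a b c e :: D)) ⊔
            pairSpan (stateB (.crossing a b c e :: D)) :=
          Submodule.mem_sup_left (pairVec_mem_pairSpan (by simp [stateA]))
        have hce : pairVec (c, e) ∈ pairSpan (stateA (.crossing a b c e :: D)) ⊔
            pairSpan (stateB (.crossing a b c e :: D)) :=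
          Submodule.mem_sup_left (pairVec_mem_pairSpan (by simp [stateA]))
        have hbc : pairVec (b, c) ∈ pairSpan (stateA (.crossing a b c e :: D)) ⊔
            pairSpan (stateB (.crossing a b c e :: D)) :=
          Submodule.mem_sup_right (pairVec_mem_pairSpan (by simp [stateB]))
        rcases h with ⟨rfl, rfl⟩ | ⟨rfl, rfl⟩
        · rw [pairVec_trans x b y]; exact add_mem hab hbc
        · rw [pairVec_trans x c y]; exact add_mem hbc hce
      · obtain ⟨rfl, rfl⟩ := h
        exact Submodule.mem_sup_left (pairVec_mem_pairSpan (by simp [stateA]))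
    · exact hle (ih hv)

theorem IsKnotDiagram.edges_ne_nil {D : Code} (h : D.IsKnotDiagram) : ∃ a, a ∈ D.edges := by
  obtain ⟨v, D, rfl⟩ := List.exists_cons_of_ne_nil h.nonempty
  cases v with
  | crossing a b c e => exact ⟨a, by simp⟩
  | path a b => exact ⟨a, by simp⟩

/-- As the diagram is connected, the two extreme states together identify all edges. -/
theorem IsKnotDiagram.le_finrank_sup {D : Code} (h : D.IsKnotDiagram) :
    D.edges.toFinset.card ≤ finrank (ZMod 2) ↥(pairSpan D.stateA ⊔ pairSpan D.stateB) + 1 := by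
  set U := pairSpan D.stateA ⊔ pairSpan D.stateB with hU
  obtain ⟨a, ha⟩ := h.edges_ne_nil
  have hpair : ∀ b ∈ D.edges, pairVec (a, b) ∈ U := by
    intro b hb
    have := h.one_component a ha b hb
    clear hb ha
    induction this with
    | rel x y h => obtain ⟨v, hv, h⟩ := h; exact pairVec_mem_of_passes hv h
    | refl x => rw [pairVec_self]; exact zero_mem _
    | symm x y _ ih => rwa [pairVec_comm]
    | trans x y z _ _ ih1 ih2 => rw [pairVec_trans x y z]; exact add_mem ih1 ih2
  have hle : Submodule.span (ZMod 2)
      (Set.range fun b : D.edges.toFinset => single (b : ℕ) (1 : ZMod 2)) ≤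
      Submodule.span (ZMod 2) {single a 1} ⊔ U := by
    refine Submodule.span_le.2 ?_
    rintro _ ⟨⟨b, hb⟩, rfl⟩
    have : single b (1 : ZMod 2) = single a 1 + pairVec (a, b) := by
      ext x
      simp only [pairVec, Finsupp.add_apply]
      linear_combination (-(single a (1 : ZMod 2)) x) * (CharTwo.two_eq_zero (R := ZMod 2))
    simp only [this]
    exact add_mem (Submodule.mem_sup_left (Submodule.mem_span_singleton_self _))
      (Submodule.mem_sup_right (hpair b (List.mem_toFinset.1 hb)))
  have hli : LinearIndependent (ZMod 2)
      (fun b : D.edges.toFinset => single (b : ℕ) (1 : ZMod 2)) :=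
    (Finsupp.linearIndependent_single_one (ZMod 2) ℕ).comp _ Subtype.val_injective
  have hr := (Submodule.finrank_mono hle).trans (Submodule.finrank_add_le_finrank_add_finrank _ _)
  rw [finrank_span_eq_card hli, Fintype.card_coe] at hr
  have h1 : finrank (ZMod 2) (Submodule.span (ZMod 2) {single a (1 : ZMod 2)}) ≤ 1 := by
    simpa using finrank_span_le_card (R := ZMod 2) {single a (1 : ZMod 2)}
  omega

theorem vertexVec_apply (v : Node) (a : ℕ) : vertexVec v a = (v.edges.count a : ZMod 2) := by
  rw [vertexVec]
  induction v.edges with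
  | nil => simp
  | cons b L ih =>
    rw [List.map_cons, List.sum_cons, Finsupp.add_apply, ih, List.count_cons, Finsupp.single_apply]
    by_cases h : b = a <;> simp [h, add_comm]

theorem sum_count (D : Code) (a : ℕ) :
    ∑ i : Fin D.length, (D.get i).edges.count a = D.edges.count a := by
  induction D with
  | nil => simp
  | cons v D ih =>
    rw [edges, List.flatMap_cons, List.count_append, ← edges, ← ih]
    exact Fin.sum_univ_succ _

/-- The vertex vectors span a space of dimension at least `D.length - 1`: in a linear relation
between them the two ends of an edge have equal coefficients, so that by connectedness all
coefficients are equal. -/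
theorem IsKnotDiagram.le_finrank_inf {D : Code} (h : D.IsKnotDiagram) :
    D.length ≤ finrank (ZMod 2) ↥(pairSpan D.stateA ⊓ pairSpan D.stateB) + 1 := by
  let Ψ : (Fin D.length → ZMod 2) →ₗ[ZMod 2] (ℕ →₀ ZMod 2) :=
    Fintype.linearCombination (ZMod 2) fun i => vertexVec (D.get i)
  have hrange : LinearMap.range Ψ ≤ pairSpan D.stateA ⊓ pairSpan D.stateB := by
    rintro _ ⟨g, rfl⟩
    simp only [Ψ, Fintype.linearCombination_apply]
    exact sum_mem fun i _ => Submodule.smul_mem _ _ (vertexVec_mem (List.get_mem _ _))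
  have hker : LinearMap.ker Ψ ≤ Submodule.span (ZMod 2) {fun _ => 1} := by
    intro g hg
    have hsum : ∀ a, ∑ i, g i * ((D.get i).edges.count a : ZMod 2) = 0 := by
      intro a
      have := DFunLike.congr_fun (LinearMap.mem_ker.1 hg) a
      simpa only [Ψ, Fintype.linearCombination_apply, Finsupp.finsetSum_apply, Finsupp.smul_apply,
        vertexVec_apply, smul_eq_mul, Finsupp.zero_apply] using this
    have hmem : ∀ i a, a ∈ (D.get i).edges → a ∈ D.edges := fun i a ha =>
      List.mem_flatMap.2 ⟨_, List.get_mem _ _, ha⟩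
    have hedge : ∀ a i j, a ∈ (D.get i).edges → a ∈ (D.get j).edges → g i = g j := by
      intro a i j hi hj
      by_cases hij : i = j
      · rw [hij]
      have h2 := sum_count D a
      rw [h.two_ends a (hmem i a hi)] at h2
      have ci := List.count_pos_iff.2 hi
      have cj := List.count_pos_iff.2 hj
      have h3 : ∀ k, k ≠ i ∧ k ≠ j → (D.get k).edges.count a = 0 := by
        rintro k ⟨hki, hkj⟩
        have := Finset.sum_le_univ_sum_of_nonneg (s := {k, i, j})
          (f := fun i => (D.get i).edges.count a) (fun _ => Nat.zero_le _)
        rw [h2, Finset.sum_insert (by simp [hki, hkj]), Finset.sum_pair hij] at this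
        omega
      have h4 := Finset.sum_eq_add (s := Finset.univ) i j hij (fun k _ => h3 k) (by simp) (by simp)
      rw [h2] at h4
      have h5 := Finset.sum_eq_add (s := Finset.univ)
        (f := fun i => g i * ((D.get i).edges.count a : ZMod 2)) i j hij
        (fun k _ hk => by simp only [h3 k hk]; simp) (by simp) (by simp)
      rw [hsum a, show (D.get i).edges.count a = 1 by omega,
        show (D.get j).edges.count a = 1 by omega, Nat.cast_one, mul_one, mul_one] at h5
      exact CharTwo.add_eq_zero.1 h5.symm
    -- The common coefficient of the vertices at an edge.
    classical
    let val : ℕ → ZMod 2 := fun a => if h : ∃ i, a ∈ (D.get i).edges then g h.choose else 0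
    have hval : ∀ i a, a ∈ (D.get i).edges → val a = g i := by
      intro i a ha
      have hex : ∃ i, a ∈ (D.get i).edges := ⟨i, ha⟩
      simp only [val, dif_pos hex]
      exact hedge a _ _ hex.choose_spec ha
    have hconst : ∀ a b, Relation.EqvGen (fun x y => ∃ v ∈ D, v.Passes x y) a b →
        val a = val b := by
      intro a b hab
      induction hab with
      | rel x y h =>
        obtain ⟨v, hv, h⟩ := h
        obtain ⟨i, rfl⟩ := List.get_of_mem hv
        have hxy : x ∈ (D.get i).edges ∧ y ∈ (D.get i).edges := by
          revert h
          rcases D.get i with ⟨a, b, c, e⟩ | ⟨a, b⟩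
          · rintro (⟨rfl, rfl⟩ | ⟨rfl, rfl⟩) <;> simp [Node.edges]
          · rintro ⟨rfl, rfl⟩; simp [Node.edges]
        rw [hval i x hxy.1, hval i y hxy.2]
      | refl x => rfl
      | symm x y _ ih => exact ih.symm
      | trans x y z _ _ ih1 ih2 => exact ih1.trans ih2
    obtain ⟨a, ha⟩ := h.edges_ne_nil
    refine Submodule.mem_span_singleton.2 ⟨val a, ?_⟩
    funext i
    obtain ⟨b, hb⟩ : ∃ b, b ∈ (D.get i).edges := by
      rcases D.get i with ⟨a, b, c, e⟩ | ⟨a, b⟩ <;> exact ⟨a, by simp [Node.edges]⟩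
    rw [Pi.smul_apply, smul_eq_mul, mul_one, hconst a b (h.one_component a ha b (hmem i b hb)),
      hval i b hb]
  have h1 := LinearMap.finrank_range_add_finrank_ker Ψ
  have h2 := Submodule.finrank_mono hrange
  have h3 := (Submodule.finrank_mono hker).trans
    (finrank_span_le_card (R := ZMod 2) {fun _ => 1})
  rw [finrank_fin_fun] at h1
  simp only [Set.toFinset_singleton, Finset.card_singleton] at h3
  omega

/-- The two extreme states of a diagram with `c` crossings have at most `c + 2` closed curves
together. This is the dimension formula for the spans `U`, `V` of the two states: with `v` vertices,
hence `v + c` edges, `dim (U + V) ≥ v + c - 1` and `dim (U ∩ V) ≥ v - 1`. -/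
theorem IsKnotDiagram.loops_add_loops_le {D : Code} (h : D.IsKnotDiagram) :
    loops D.stateA + loops D.stateB ≤ D.crossings + 2 := by
  have h1 := h.le_finrank_sup
  have h2 := h.le_finrank_inf
  have h3 := h.card_edges
  have h4 := Submodule.finrank_sup_add_finrank_inf_eq (pairSpan D.stateA) (pairSpan D.stateB)
  have h5 := finrank_pairSpan_le D.stateA
  have h6 := finrank_pairSpan_le D.stateB
  rw [loops, loops]
  rw [names_stateA] at *
  rw [names_stateB] at *
  omega

/-- The span of the bracket is at most four times the number of crossings; the summand `4` comes
from the normalization, by which every state has an additional factor `loopValue`. -/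
theorem IsKnotDiagram.bracket_supportedIn {D : Code} (h : D.IsKnotDiagram) :
    ∃ l : ℤ, SupportedIn (bracket D) l (l + 4 * D.crossings + 4) := by
  have h1 := stateSum_supportedIn D []
  have h2 := h.loops_add_loops_le
  simp only [List.append_nil] at h1
  exact ⟨_, h1.mono le_rfl (by omega)⟩

end Code

/-- The lower bound for the crossing number by the span of the bracket. It is stated for
`loopValue * bracket D`, whose span is `4 * c + 8` when that of the normalized bracket is `4 * c`. -/
theorem le_crossingNumber (D : KnotDiagram) {l u : ℤ} {n : ℕ}
    (hl : (loopValue * bracket D.1).coeff l ≠ 0) (hu : (loopValue * bracket D.1).coeff u ≠ 0)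
    (hlu : l + 4 * n + 8 ≤ u) : n ≤ D.knot.crossingNumber := by
  obtain ⟨D', hD', hc⟩ : D.knot.crossingNumber ∈
      {c | ∃ D' : KnotDiagram, D'.knot = D.knot ∧ D'.1.crossings = c} :=
    Nat.sInf_mem ⟨_, D, rfl, rfl⟩
  obtain ⟨m, hm⟩ := D'.2.bracket_supportedIn
  obtain ⟨k, hk⟩ := SupportedIn.of_unitEquiv (bracket_knot hD').symm hm
  have h1 := hk.loopValue_mul l hl
  have h2 := hk.loopValue_mul u hu
  omega

/-! ### Computing brackets -/

/-- The Laurent polynomial with the coefficients `l` at `T ^ n, T ^ (n + 2), T ^ (n + 4), …`. -/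
noncomputable def ofList (n : ℤ) : List ℤ → ℤ[T;T⁻¹]
  | [] => 0
  | a :: l => C a * T n + ofList (n + 2) l

namespace EvalList

/-- Addition of coefficient lists. -/
def add : List ℤ → List ℤ → List ℤ
  | [], m => m
  | a :: l, [] => a :: l
  | a :: l, b :: m => (a + b) :: add l m

/-- The coefficients of `loopValue ^ n`, starting with that of `T ^ (-2 * n)`. -/
def loopPow : ℕ → List ℤ
  | 0 => [1]
  | n + 1 => (add (loopPow n) (0 :: 0 :: loopPow n)).map Neg.neg

/-- The dimension of `pairSpan L` for lists `L` of length at most the first argument, computed by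
contracting edges. -/
def rank : ℕ → List (ℕ × ℕ) → ℕ
  | 0, _ => 0
  | _, [] => 0
  | n + 1, (a, b) :: L =>
    if a = b then rank n L else rank n (L.map (Prod.map (mergeName a b) (mergeName a b))) + 1

/-- The coefficients of the state sum of a code with `N` edges, starting with that of
`T ^ (-2 * N - c)`, where `c` is the number of crossings. -/
def stateSum (N : ℕ) : Code → List (ℕ × ℕ) → List ℤ
  | [], L => List.replicate (rank L.length L) 0 ++ loopPow (N - rank L.length L)
  | .crossing a b c e :: D, L =>
    add (0 :: stateSum N D ((c, e) :: (a, b) :: L)) (stateSum N D ((b, c) :: (a, e) :: L))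
  | .path a b :: D, L => stateSum N D ((a, b) :: L)

end EvalList

theorem ofList_add (n : ℤ) (l m : List ℤ) :
    ofList n (EvalList.add l m) = ofList n l + ofList n m := by
  induction l generalizing n m with
  | nil => simp [EvalList.add, ofList]
  | cons a l ih =>
    cases m with
    | nil => simp [EvalList.add, ofList]
    | cons b m => simp only [EvalList.add, ofList, ih, map_add]; ring

theorem ofList_neg (n : ℤ) (l : List ℤ) : ofList n (l.map Neg.neg) = -ofList n l := by
  induction l generalizing n with
  | nil => simp [ofList]
  | cons a l ih => simp only [List.map_cons, ofList, ih, map_neg]; ring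

theorem T_mul_ofList (k n : ℤ) (l : List ℤ) : T k * ofList n l = ofList (n + k) l := by
  induction l generalizing n with
  | nil => simp [ofList]
  | cons a l ih =>
    rw [ofList, ofList, mul_add, ih, T_add, add_right_comm]
    ring

theorem ofList_zero_cons (n : ℤ) (l : List ℤ) : ofList n (0 :: l) = ofList (n + 2) l := by
  simp [ofList]

theorem ofList_replicate_append (k : ℕ) (n : ℤ) (l : List ℤ) :
    ofList n (List.replicate k 0 ++ l) = ofList (n + 2 * k) l := by
  induction k generalizing n with
  | zero => simp
  | succ k ih =>
    rw [List.replicate_succ, List.cons_append, ofList_zero_cons, ih]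
    congr 1
    push_cast
    ring

theorem ofList_loopPow (n : ℕ) : ofList (-(2 * n)) (EvalList.loopPow n) = loopValue ^ n := by
  induction n with
  | zero => simp [EvalList.loopPow, ofList]
  | succ n ih =>
    rw [EvalList.loopPow, ofList_neg, ofList_add, ofList_zero_cons, ofList_zero_cons, pow_succ',
      ← ih,
      loopValue, sub_mul, neg_mul, T_mul_ofList, T_mul_ofList]
    push_cast
    ring_nf

theorem finrank_eq_rank (n : ℕ) (L : List (ℕ × ℕ)) (h : L.length ≤ n) :
    finrank (ZMod 2) (pairSpan L) = EvalList.rank n L := by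
  have h0 : finrank (ZMod 2) (pairSpan []) = 0 := by
    have : pairSpan [] = ⊥ := by simp [pairSpan]
    rw [this, finrank_bot]
  induction n generalizing L with
  | zero => rw [List.length_eq_zero_iff.1 (Nat.le_zero.1 h)]; simpa [EvalList.rank] using h0
  | succ n ih =>
    cases L with
    | nil => simpa [EvalList.rank] using h0
    | cons p L =>
      obtain ⟨a, b⟩ := p
      simp only [List.length_cons, Nat.add_le_add_iff_right] at h
      rw [EvalList.rank]
      split_ifs with hab
      · rw [← ih L h, hab, pairSpan_cons, pairVec_self, Submodule.span_zero_singleton, bot_sup_eq]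
      · rw [finrank_pairSpan_cons hab, ih _ (by simpa using h)]

theorem stateSum_eq_ofList (N : ℕ) (D : Code) (L : List (ℕ × ℕ))
    (hN : (names L ∪ D.edges.toFinset).card = N) :
    stateSum D L = ofList (-(2 * N) - D.crossings) (EvalList.stateSum N D L) := by
  induction D generalizing L with
  | nil =>
    simp only [Code.edges_nil, List.toFinset_nil, Finset.union_empty] at hN
    have h := finrank_pairSpan_le L
    rw [finrank_eq_rank _ L le_rfl] at h
    rw [stateSum, EvalList.stateSum, loops, finrank_eq_rank _ L le_rfl, hN,
      ofList_replicate_append, ← ofList_loopPow]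
    congr 1
    rw [hN] at h
    have : Code.crossings [] = 0 := rfl
    rw [this]
    push_cast [h]
    ring
  | cons v D ih =>
    cases v with
    | path a b =>
      rw [stateSum, EvalList.stateSum, Code.crossings_path]
      refine ih _ ?_
      rw [← hN]
      congr 1
      ext x
      simp
    | crossing a b c e =>
      rw [stateSum, EvalList.stateSum, Code.crossings_crossing, ih, ih, ofList_add,
        ofList_zero_cons, T_mul_ofList, T_mul_ofList]
      · congr 2 <;> (push_cast; ring)
      · rw [← hN]
        congr 1
        ext x
        simp
        tauto
      · rw [← hN]
        congr 1
        ext x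
        simp
        tauto

theorem coeff_ofList_cons (n k a : ℤ) (l : List ℤ) :
    (ofList n (a :: l)).coeff k = (if k = n then a else 0) + (ofList (n + 2) l).coeff k := by
  rw [ofList, AddMonoidAlgebra.coeff_add, Finsupp.add_apply, mul_comm, coeff_T_mul, C_apply]
  simp only [sub_eq_zero]

theorem coeff_ofList_of_lt {n k : ℤ} {l : List ℤ} (h : k < n) : (ofList n l).coeff k = 0 := by
  induction l generalizing n with
  | nil => simp [ofList]
  | cons a l ih => rw [coeff_ofList_cons, ih (by omega), if_neg (by omega), add_zero]

theorem coeff_ofList_of_gt {n k : ℤ} {l : List ℤ} (h : n + 2 * l.length ≤ k) :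
    (ofList n l).coeff k = 0 := by
  induction l generalizing n with
  | nil => simp [ofList]
  | cons a l ih =>
    rw [List.length_cons] at h
    push_cast at h
    rw [coeff_ofList_cons, ih (by omega), if_neg (by omega), add_zero]

theorem coeff_ofList {n k : ℤ} (i : ℕ) {l : List ℤ} (h : k = n + 2 * i) :
    (ofList n l).coeff k = l.getD i 0 := by
  induction l generalizing n i with
  | nil => simp [ofList]
  | cons a l ih =>
    rw [coeff_ofList_cons]
    cases i with
    | zero => rw [coeff_ofList_of_lt (by omega), if_pos (by omega)]; simp
    | succ i =>
      rw [ih i (by push_cast at h; omega), if_neg (by push_cast at h; omega)]; simp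

theorem bracket_outside_zero : bracket (TwistFamily.outside 16 17) =
    ofList (-19) [-1,0,2,0,-2,0,3,0,0,0,1,0,1,0,-3,0,2,0,-2,0,1] := by
  have h : EvalList.stateSum 18 (TwistFamily.outside 16 17) [] = List.replicate 13 0 ++
      [-1,0,2,0,-2,0,3,0,0,0,1,0,1,0,-3,0,2,0,-2,0,1] := by decide +kernel
  rw [bracket, stateSum_eq_ofList 18 _ _ (by decide +kernel), h, ofList_replicate_append]
  rfl

theorem bracket_outside_infty : bracket (.path 16 17 :: TwistFamily.outside 18 18) =
    ofList (-17) [1,0,-1,0,1,0,-3,0,-1,0,-1,0,0,0,2,0,-2,0,1,0,-1] := by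
  have h : EvalList.stateSum 19 (.path 16 17 :: TwistFamily.outside 18 18) [] =
    List.replicate 15 0 ++
      [1,0,-1,0,1,0,-3,0,-1,0,-1,0,0,0,2,0,-2,0,1,0,-1] := by decide +kernel
  rw [bracket, stateSum_eq_ofList 19 _ _ (by decide +kernel), h, ofList_replicate_append]
  rfl

/-! ### The brackets of the twist family -/

namespace TwistFamily

/-- The half twists in the box. -/
def twists (p : Bool) (m : ℕ) : Code := (List.range m).map (halfTwist p)

theorem twists_succ (p : Bool) (m : ℕ) : twists p (m + 1) = twists p m ++ [halfTwist p m] := by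
  simp [twists, List.range_succ]

theorem lt_of_mem_edges_twists {p : Bool} {m x : ℕ} (h : x ∈ (twists p m).edges) :
    16 ≤ x ∧ x < 18 + 2 * m := by
  have h := List.count_pos_iff.2 h
  rw [Code.edges, twists, count_twists] at h
  split_ifs at h <;> omega

theorem rename_outside {f : ℕ → ℕ} (hf : ∀ x < 18, f x = x) (s t : ℕ) :
    (outside s t).map (Node.rename f) = outside (f s) (f t) := by
  simp [outside, Node.rename, hf]

/-- The exponent of `A` in the smoothing of a half twist into a lower and an upper arc. -/
def sgn (p : Bool) : ℤ := if p then 1 else -1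

theorem bracket_halfTwist (p : Bool) (i : ℕ) (D : Code) :
    bracket (halfTwist p i :: D) =
      T (sgn p) * bracket (.path (16 + 2 * i) (17 + 2 * i) ::
          .path (19 + 2 * i) (18 + 2 * i) :: D) +
        T (-sgn p) * bracket (.path (16 + 2 * i) (18 + 2 * i) ::
          .path (17 + 2 * i) (19 + 2 * i) :: D) := by
  cases p
  · simp only [halfTwist, sgn, Bool.false_eq_true, if_false]
    rw [bracket_crossing, add_comm, bracket_path_comm (17 + 2 * i) (16 + 2 * i),
      bracket_perm (List.Perm.swap (.path (18 + 2 * i) (16 + 2 * i)) _ _),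
      bracket_path_comm (18 + 2 * i) (16 + 2 * i), neg_neg]
  · simp only [halfTwist, sgn, if_true]
    rw [bracket_crossing, bracket_perm (List.Perm.swap (.path (17 + 2 * i) (19 + 2 * i))
      (.path (16 + 2 * i) (18 + 2 * i)) D),
      bracket_perm (List.Perm.swap (.path (16 + 2 * i) (18 + 2 * i))
      (.path (17 + 2 * i) (19 + 2 * i)) D)]

theorem T_mul_loopValue_add (p : Bool) :
    T (sgn p) * loopValue + T (-sgn p) = -T (3 * sgn p) := by
  cases p <;> simp only [sgn, loopValue, mul_sub, mul_neg, ← T_add] <;> norm_num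
  abel

/-- The bracket of the diagram in which `i` half twists are closed by an arc at the top, and the
upper ends `s` of the outside are joined to each other. -/
noncomputable def closed (p : Bool) (i s : ℕ) : ℤ[T;T⁻¹] :=
  bracket (.path (16 + 2 * i) (17 + 2 * i) :: (twists p i ++ outside s s))

/-- The highest half twist below the closing arc is a kink. -/
theorem closed_succ (p : Bool) (i s : ℕ) (hs : 20 + 2 * i ≤ s) :
    closed p (i + 1) s = -T (3 * sgn p) * closed p i s := by
  have hperm : List.Perm (.path (16 + 2 * (i + 1)) (17 + 2 * (i + 1)) ::
      (twists p (i + 1) ++ outside s s)) (halfTwist p i :: .path (18 + 2 * i) (19 + 2 * i) ::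
        (twists p i ++ outside s s)) := by
    rw [twists_succ, List.append_assoc, show 16 + 2 * (i + 1) = 18 + 2 * i by ring,
      show 17 + 2 * (i + 1) = 19 + 2 * i by ring]
    exact (List.perm_middle.cons _).trans (List.Perm.swap _ _ _)
  have hfresh : ∀ x, 18 + 2 * i ≤ x → x < s → x ∉ (twists p i ++ outside s s).edges := by
    intro x hx hxs h
    rw [Code.edges_append, List.mem_append] at h
    rcases h with h | h
    · have := lt_of_mem_edges_twists h; omega
    · have := List.count_pos_iff.2 h
      rw [Code.edges, count_outside] at this
      split_ifs at this <;> omega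
  have h18 := hfresh (18 + 2 * i) (by omega) (by omega)
  have h19 := hfresh (19 + 2 * i) (by omega) (by omega)
  rw [closed, bracket_perm hperm, bracket_halfTwist, ← T_mul_loopValue_add, add_mul]
  congr 1
  · have e : List.Perm (Node.path (16 + 2 * i) (17 + 2 * i) :: .path (19 + 2 * i) (18 + 2 * i) ::
        .path (18 + 2 * i) (19 + 2 * i) :: (twists p i ++ outside s s))
        (.path (19 + 2 * i) (18 + 2 * i) :: .path (18 + 2 * i) (19 + 2 * i) ::
          .path (16 + 2 * i) (17 + 2 * i) :: (twists p i ++ outside s s)) :=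
      (List.perm_middle (l₁ := [_, _])).symm
    rw [bracket_perm e, bracket_join (by omega) (by omega) (by simpa using h18),
      bracket_circle (by simpa using h19),
      mul_assoc, closed]
  · congr 1
    have e : List.Perm (Node.path (16 + 2 * i) (18 + 2 * i) :: .path (17 + 2 * i) (19 + 2 * i) ::
        .path (18 + 2 * i) (19 + 2 * i) :: (twists p i ++ outside s s))
        (.path (16 + 2 * i) (18 + 2 * i) :: .path (18 + 2 * i) (19 + 2 * i) ::
          .path (17 + 2 * i) (19 + 2 * i) :: (twists p i ++ outside s s)) :=
      (List.Perm.swap _ _ _).cons _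
    rw [bracket_perm e, bracket_join (by omega) (by omega) (by simpa using h18),
      bracket_perm (List.Perm.swap _ _ _), bracket_path_comm,
      bracket_perm (List.Perm.swap _ _ _), bracket_join (by omega) (by omega) h19, closed]

theorem closed_eq (p : Bool) (i s : ℕ) (hs : 18 + 2 * i ≤ s) :
    closed p i s = (-T (3 * sgn p)) ^ i * bracket (.path 16 17 :: outside 18 18) := by
  induction i with
  | zero =>
    have hf : ∀ x < 18, Equiv.swap s 18 x = x := fun x hx =>
      Equiv.swap_apply_of_ne_of_ne (by omega) (by omega)
    rw [pow_zero, one_mul, closed, ← bracket_rename (Equiv.swap s 18).injective]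
    simp only [twists, List.range_zero, List.map_nil, List.nil_append, List.map_cons]
    rw [rename_outside hf, Equiv.swap_apply_left, Node.rename, hf _ (by omega), hf _ (by omega)]
  | succ i ih => rw [closed_succ p i s (by omega), ih (by omega), pow_succ']; ring

/-- Smoothing the highest half twist either removes it or closes the box. -/
theorem bracket_code_succ (p : Bool) (m : ℕ) :
    bracket (code p (m + 1)) = T (-sgn p) * bracket (code p m) +
      T (sgn p) * closed p m (19 + 2 * m) := by
  have hperm : (code p (m + 1)).Perm
      (halfTwist p m :: (twists p m ++ outside (18 + 2 * m) (19 + 2 * m))) := by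
    have : code p (m + 1) =
        outside (18 + 2 * m) (19 + 2 * m) ++ (twists p m ++ [halfTwist p m]) := by
      rw [← twists_succ, twists, code]
      congr 2 <;> ring
    rw [this, ← List.append_assoc]
    exact (List.perm_append_singleton _ _).trans (List.perm_append_comm.cons _)
  have hfix : ∀ a b, 18 + 2 * m ≤ b → (twists p m).map (Node.rename (mergeName a b)) = twists p m :=
    fun a b hb => Code.map_mergeName fun h => by have := lt_of_mem_edges_twists h; omega
  have hlow : ∀ a b, 18 + 2 * m ≤ b → ∀ x < 18, mergeName a b x = x := fun a b hb x hx =>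
    if_neg (by omega)
  rw [bracket_perm hperm, bracket_halfTwist, add_comm]
  congr 2
  · rw [bracket_merge (by omega) (Or.inr (by simp [outside])), List.map_cons, List.map_append,
      hfix _ _ le_rfl, rename_outside (hlow _ _ le_rfl)]
    have e1 : Node.rename (mergeName (16 + 2 * m) (18 + 2 * m)) (.path (17 + 2 * m) (19 + 2 * m)) =
        .path (17 + 2 * m) (19 + 2 * m) := by simp [Node.rename, mergeName]
    have e2 : mergeName (16 + 2 * m) (18 + 2 * m) (18 + 2 * m) = 16 + 2 * m := by simp [mergeName]
    have e3 : mergeName (16 + 2 * m) (18 + 2 * m) (19 + 2 * m) = 19 + 2 * m := by simp [mergeName]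
    rw [e1, e2, e3, bracket_merge (by omega) (Or.inr (by simp [outside])), List.map_append,
      hfix _ _ (by omega), rename_outside (hlow _ _ (by omega))]
    have e4 : mergeName (17 + 2 * m) (19 + 2 * m) (16 + 2 * m) = 16 + 2 * m := by simp [mergeName]
    have e5 : mergeName (17 + 2 * m) (19 + 2 * m) (19 + 2 * m) = 17 + 2 * m := by simp [mergeName]
    rw [e4, e5, code, twists, bracket_perm List.perm_append_comm]
  · rw [bracket_perm (List.Perm.swap _ _ _), bracket_merge (by omega) (Or.inr (by simp [outside])),
      List.map_cons, List.map_append, hfix _ _ le_rfl, rename_outside (hlow _ _ le_rfl)]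
    have e1 : Node.rename (mergeName (19 + 2 * m) (18 + 2 * m)) (.path (16 + 2 * m) (17 + 2 * m)) =
        .path (16 + 2 * m) (17 + 2 * m) := by simp [Node.rename, mergeName]
    have e2 : mergeName (19 + 2 * m) (18 + 2 * m) (18 + 2 * m) = 19 + 2 * m := by simp [mergeName]
    have e3 : mergeName (19 + 2 * m) (18 + 2 * m) (19 + 2 * m) = 19 + 2 * m := by simp [mergeName]
    rw [e1, e2, e3, closed]

/-- The bracket for `m` half twists in terms of the brackets for the two trivial fillings of the
box. The factor `loopValue` clears the denominator of the geometric sum of the kink factors. -/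
theorem loopValue_mul_bracket_code (p : Bool) (m : ℕ) :
    loopValue * bracket (code p m) =
      T (-(m * sgn p)) * (loopValue * bracket (outside 16 17) -
          bracket (.path 16 17 :: outside 18 18)) +
        (-T (3 * sgn p)) ^ m * bracket (.path 16 17 :: outside 18 18) := by
  induction m with
  | zero => simp [code]
  | succ m ih =>
    have e : (T (-((m + 1 : ℕ) * sgn p)) : ℤ[T;T⁻¹]) = T (-sgn p) * T (-(m * sgn p)) := by
      rw [← T_add]; congr 1; push_cast; ring
    have h1 := T_mul_loopValue_add p
    have h2 : (T (-sgn p) : ℤ[T;T⁻¹]) = -T (3 * sgn p) - T (sgn p) * loopValue := by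
      rw [← h1]; ring
    rw [bracket_code_succ, closed_eq _ _ _ (by omega), mul_add, mul_left_comm, ih, e, pow_succ',
      ← h1]
    ring

/-- The last summand moves away from the other ones as `m` grows, so that the extreme coefficients
can be read off. -/
theorem coeff_bracket_code (p : Bool) {m : ℕ} (hm : Odd m) (k : ℤ) :
    (loopValue * bracket (code p m)).coeff k =
      -(bracket (outside 16 17)).coeff (k + m * sgn p - 2) -
        (bracket (outside 16 17)).coeff (k + m * sgn p + 2) -
        (bracket (.path 16 17 :: outside 18 18)).coeff (k + m * sgn p) -
        (bracket (.path 16 17 :: outside 18 18)).coeff (k - 3 * (m * sgn p)) := by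
  have e : loopValue * bracket (code p m) =
      -(T (-(m * sgn p) + 2) * bracket (outside 16 17)) -
      T (-(m * sgn p) - 2) * bracket (outside 16 17) -
      T (-(m * sgn p)) * bracket (.path 16 17 :: outside 18 18) -
      T (3 * (m * sgn p)) * bracket (.path 16 17 :: outside 18 18) := by
    rw [loopValue_mul_bracket_code, hm.neg_pow, T_pow, sub_eq_add_neg (-((m : ℤ) * sgn p)) 2, T_add,
      T_add, loopValue, show (m : ℤ) * (3 * sgn p) = 3 * (m * sgn p) by ring]
    ring
  rw [e]
  simp only [AddMonoidAlgebra.coeff_sub, AddMonoidAlgebra.coeff_neg, Finsupp.sub_apply,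
    Finsupp.neg_apply, coeff_T_mul]
  ring_nf

/-- The diagram `code p m` as a knot diagram. -/
def diagram (p : Bool) (m : ℕ) (hm : Odd m) : KnotDiagram := ⟨code p m, isKnotDiagram p m hm⟩

theorem le_crossingNumber_true {m : ℕ} (hm : Odd m) :
    9 + m ≤ (diagram true m hm).knot.crossingNumber := by
  have hpos := hm.pos
  have hs : sgn true = 1 := rfl
  refine le_crossingNumber (diagram true m hm) (l := -21 - m) (u := 23 + 3 * m) ?_ ?_
    (by push_cast; omega)
  all_goals
    change (loopValue * bracket (code true m)).coeff _ ≠ 0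
    rw [coeff_bracket_code _ hm, bracket_outside_zero, bracket_outside_infty, hs, mul_one]
  · rw [coeff_ofList_of_lt, coeff_ofList 0, coeff_ofList_of_lt, coeff_ofList_of_lt]
    · decide
    all_goals push_cast; omega
  · rw [coeff_ofList_of_gt, coeff_ofList_of_gt, coeff_ofList_of_gt, coeff_ofList 20]
    · decide
    · push_cast; ring
    all_goals simp only [List.length_cons, List.length_nil]; push_cast; omega

theorem le_crossingNumber_false {m : ℕ} (hm : Odd m) (h3 : 3 ≤ m) :
    6 + m ≤ (diagram false m hm).knot.crossingNumber := by
  have hs : sgn false = -1 := rfl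
  refine le_crossingNumber (diagram false m hm) (l := -17 - 3 * m) (u := 15 + m) ?_ ?_
    (by push_cast; omega)
  all_goals
    change (loopValue * bracket (code false m)).coeff _ ≠ 0
    rw [coeff_bracket_code _ hm, bracket_outside_zero, bracket_outside_infty, hs, mul_neg_one]
  · rw [coeff_ofList_of_lt, coeff_ofList_of_lt, coeff_ofList_of_lt, coeff_ofList 0]
    · decide
    · push_cast; ring
    all_goals omega
  · rw [coeff_ofList 16, coeff_ofList 18, coeff_ofList 16, coeff_ofList_of_gt]
    · decide
    · simp only [List.length_cons, List.length_nil]; push_cast; omega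
    all_goals push_cast; ring

/-- For a single half twist the summands of `coeff_bracket_code` overlap more: the lowest term from
`le_crossingNumber_false` cancels, and there is a higher term than the one used there. The bound is
given by the same formula. -/
theorem le_crossingNumber_one :
    7 ≤ (diagram false 1 odd_one).knot.crossingNumber := by
  have hs : sgn false = -1 := rfl
  refine le_crossingNumber (diagram false 1 odd_one) (l := -16) (u := 20) ?_ ?_ (by norm_num)
  all_goals
    change (loopValue * bracket (code false 1)).coeff _ ≠ 0
    rw [coeff_bracket_code _ odd_one, bracket_outside_zero, bracket_outside_infty, hs]
  · rw [coeff_ofList 0, coeff_ofList 2, coeff_ofList 0, coeff_ofList 2]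
    · decide
    all_goals norm_num
  · rw [coeff_ofList 18, coeff_ofList 20, coeff_ofList 18, coeff_ofList 20]
    · decide
    all_goals norm_num

end TwistFamily

/-! ### Recognizing knot diagrams -/

namespace Code

namespace Check

/-- The edges at the vertex number `i`. -/
def edgesAt (D : Code) (i : ℕ) : List ℕ := (D.getD i (.path 0 0)).edges

/-- The edge of the dart `x`, given by the number of a vertex and a place at it. -/
def edgeAt (D : Code) (x : ℕ × ℕ) : ℕ := (edgesAt D x.1).getD x.2 0

/-- All darts, as pairs of a vertex number and a place. -/
def darts (D : Code) : List (ℕ × ℕ) :=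
  (List.range D.length).flatMap fun i => (List.range (edgesAt D i).length).map fun k => (i, k)

/-- The counterclockwise next dart at the same vertex. -/
def next (D : Code) (x : ℕ × ℕ) : ℕ × ℕ := (x.1, (x.2 + 1) % (edgesAt D x.1).length)

/-- The dart which represents the following corner of the same region. -/
def succ (D : Code) (x : ℕ × ℕ) : ℕ × ℕ :=
  ((darts D).find? fun y => edgeAt D (next D x) == edgeAt D y && next D x != y).getD x

/-- The lexicographic minimum. -/
def least (x y : ℕ × ℕ) : ℕ × ℕ := if x.1 < y.1 ∨ x.1 = y.1 ∧ x.2 < y.2 then x else y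

/-- The least of `b` and the corners met on the way along the boundary of a region from `y` to `x`,
in at most the given number of steps. -/
def walk (D : Code) (x : ℕ × ℕ) : ℕ → ℕ × ℕ → ℕ × ℕ → ℕ × ℕ
  | 0, _, b => b
  | n + 1, y, b => if y = x then b else walk D x n (succ D y) (least y b)

/-- The least corner of the region of `x`. -/
def rep (D : Code) (x : ℕ × ℕ) : ℕ × ℕ := walk D x (darts D).length (succ D x) x

/-- The pairs of edges which follow each other on a strand. -/
def links (D : Code) : List (ℕ × ℕ) := D.flatMap fun
  | .crossing a b c d => [(a, c), (b, d)]
  | .path a b => [(a, b)]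

/-- Adds one edge of a link to a list which contains the other one. -/
def extend (L : List ℕ) (p : ℕ × ℕ) : List ℕ :=
  if p.1 ∈ L then p.2 :: L else if p.2 ∈ L then p.1 :: L else L

/-- Edges which can be reached from the first edge by travelling along strands. -/
def reach (D : Code) : ℕ → List ℕ
  | 0 => D.edges.take 1
  | n + 1 => (links D).foldl extend (reach D n)

end Check

open Check

/-- A decidable condition for being a knot diagram. Regions are counted by their least corners; that
the computed corners are constant on regions and lie in them is part of the condition, so that
nothing has to be proved about the algorithm. -/
def Check (D : Code) : Prop :=
  D ≠ [] ∧ (∀ a ∈ D.edges, D.edges.count a = 2) ∧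
  (∀ a ∈ D.edges, a ∈ reach D D.length) ∧
  (∀ x ∈ darts D, succ D x ∈ darts D ∧ edgeAt D (next D x) = edgeAt D (succ D x) ∧
    next D x ≠ succ D x) ∧
  (∀ x ∈ darts D, ∀ y ∈ darts D, edgeAt D (next D x) = edgeAt D y → next D x ≠ y →
    rep D x = rep D y) ∧
  ((darts D).map (rep D)).dedup.length = D.crossings + 2

instance (D : Code) : Decidable (Check D) := by unfold Check; infer_instance

namespace Check

variable {D : Code}

/-- The number of the vertex of a dart and its place. -/
def toPair (x : Dart D) : ℕ × ℕ := (x.1, x.2)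

theorem edgesAt_eq (i : Fin D.length) : edgesAt D i = (D.get i).edges := by
  rw [edgesAt, List.getD_eq_getElem _ _ i.2]; rfl

theorem edge_eq (x : Dart D) : x.edge = edgeAt D (toPair x) := by
  have h : (x.2 : ℕ) < (edgesAt D x.1).length := by rw [edgesAt_eq]; exact x.2.2
  simp only [edgeAt, toPair]
  rw [List.getD_eq_getElem _ _ h]
  simp only [edgesAt_eq]
  rfl

theorem toPair_next (x : Dart D) : toPair x.next = next D (toPair x) := by
  simp only [toPair, next, edgesAt_eq]
  rfl

theorem toPair_injective : Function.Injective (toPair (D := D)) := by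
  rintro ⟨i, k⟩ ⟨j, l⟩ h
  obtain rfl : i = j := Fin.ext (congrArg Prod.fst h)
  obtain rfl : k = l := Fin.ext (congrArg Prod.snd h)
  rfl

theorem mem_darts {x : ℕ × ℕ} : x ∈ darts D ↔ ∃ d : Dart D, toPair d = x := by
  obtain ⟨i, k⟩ := x
  simp only [darts, List.mem_flatMap, List.mem_range, List.mem_map, Prod.mk.injEq, toPair]
  constructor
  · rintro ⟨i, hi, k, hk, rfl, rfl⟩
    have e := edgesAt_eq (D := D) ⟨i, hi⟩
    simp only at e
    exact ⟨⟨⟨i, hi⟩, ⟨k, by rw [← e]; exact hk⟩⟩, rfl, rfl⟩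
  · rintro ⟨⟨i, k⟩, rfl, rfl⟩
    exact ⟨i, i.2, k, by rw [edgesAt_eq]; exact k.2, rfl, rfl⟩

theorem isKnotDiagram (h : Check D) : D.IsKnotDiagram := by
  obtain ⟨hne, h2, hconn, hsucc, hrep, hcard⟩ := h
  refine ⟨h2, hne, ?_, ?_⟩
  · obtain ⟨a0, ha0⟩ : ∃ a0, D.edges.take 1 = [a0] := by
      obtain ⟨v, D, rfl⟩ := List.exists_cons_of_ne_nil hne
      cases v with
      | crossing a b c e => exact ⟨a, rfl⟩
      | path a b => exact ⟨a, rfl⟩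
    set R := Relation.EqvGen (fun x y => ∃ v ∈ D, v.Passes x y) with hR
    have hE : Equivalence R := Relation.EqvGen.is_equivalence _
    have hlink : ∀ p ∈ links D, R p.1 p.2 := by
      intro p hp
      obtain ⟨v, hv, hp⟩ := List.mem_flatMap.1 hp
      refine .rel _ _ ⟨v, hv, ?_⟩
      cases v <;> simp at hp
      · rcases hp with rfl | rfl <;> simp [Node.Passes]
      · subst hp; simp [Node.Passes]
    have hfold : ∀ (P : List (ℕ × ℕ)) (L : List ℕ), (∀ p ∈ P, R p.1 p.2) → (∀ b ∈ L, R a0 b) →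
        ∀ b ∈ P.foldl extend L, R a0 b := by
      intro P
      induction P with
      | nil => intro L _ hL; exact hL
      | cons p P ih =>
        intro L hP hL
        have hp := hP p (by simp)
        refine ih _ (fun q hq => hP q (by simp [hq])) ?_
        intro b hb
        unfold extend at hb
        split_ifs at hb with h1 h2
        · rcases List.mem_cons.1 hb with rfl | hb
          exacts [hE.trans (hL _ h1) hp, hL b hb]
        · rcases List.mem_cons.1 hb with rfl | hb
          exacts [hE.trans (hL _ h2) (hE.symm hp), hL b hb]
        · exact hL b hb
    have hreach : ∀ n, ∀ b ∈ reach D n, R a0 b := by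
      intro n
      induction n with
      | zero =>
        intro b hb
        rw [reach, ha0, List.mem_singleton] at hb
        rw [hb]
        exact hE.refl _
      | succ n ih => exact hfold _ _ hlink ih
    exact fun a ha b hb => hE.trans (hE.symm (hreach _ a (hconn a ha))) (hreach _ b (hconn b hb))
  · -- Corners with the same representative lie in the same region.
    let S : ℕ × ℕ → ℕ × ℕ → Prop := fun x y => ∀ d d' : Dart D, toPair d = x → toPair d' = y →
      (Quot.mk _ d : Region D) = Quot.mk _ d'
    have hSsucc : ∀ x ∈ darts D, S x (succ D x) := by
      rintro x hx d d' rfl hd'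
      obtain ⟨-, h1, h3⟩ := hsucc _ hx
      refine Quot.sound ⟨fun h => h3 ?_, ?_⟩
      · rw [← toPair_next, h, hd']
      · rw [edge_eq, edge_eq, toPair_next, h1, hd']
    have hStrans : ∀ x y z, y ∈ darts D → S x y → S y z → S x z := by
      intro x y z hy h1 h2 d d' hd hd'
      obtain ⟨e, he⟩ := mem_darts.1 hy
      exact (h1 d e hd he).trans (h2 e d' he hd')
    have hwalk : ∀ x n y b, y ∈ darts D → b ∈ darts D → S x y → S x b →
        walk D x n y b ∈ darts D ∧ S x (walk D x n y b) := by
      intro x n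
      induction n with
      | zero => intro y b _ hb _ h; exact ⟨hb, h⟩
      | succ n ih =>
        intro y b hy hb h1 h2
        rw [walk]
        split_ifs
        · exact ⟨hb, h2⟩
        · refine ih _ _ (hsucc y hy).1 ?_ (hStrans _ _ _ hy h1 (hSsucc y hy)) ?_ <;>
            (unfold least; split_ifs <;> assumption)
    have hSrep : ∀ x ∈ darts D, rep D x ∈ darts D ∧ S x (rep D x) := by
      intro x hx
      refine hwalk x _ _ _ (hsucc x hx).1 hx (hSsucc x hx) ?_
      rintro d d' rfl hd'
      rw [toPair_injective hd']
    let F : Region D → ℕ × ℕ := Quot.lift (fun d => rep D (toPair d)) fun d d' h =>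
      hrep _ (mem_darts.2 ⟨d, rfl⟩) _ (mem_darts.2 ⟨d', rfl⟩)
        (by rw [← toPair_next, ← edge_eq, ← edge_eq]; exact h.2)
        (by rw [← toPair_next]; exact fun e => h.1 (toPair_injective e))
    have hF : Function.Injective F := by
      intro r r' h
      induction r using Quot.ind with | _ d
      induction r' using Quot.ind with | _ d'
      change rep D (toPair d) = rep D (toPair d') at h
      obtain ⟨m1, s1⟩ := hSrep _ (mem_darts.2 ⟨d, rfl⟩)
      obtain ⟨-, s2⟩ := hSrep _ (mem_darts.2 ⟨d', rfl⟩)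
      obtain ⟨e, he⟩ := mem_darts.1 m1
      exact (s1 d e rfl he).trans (s2 d' e rfl (he.trans h)).symm
    have hrange : Set.range F = (((darts D).map (rep D)).toFinset : Set (ℕ × ℕ)) := by
      ext x
      simp only [Set.mem_range, Finset.mem_coe, List.mem_toFinset, List.mem_map]
      constructor
      · rintro ⟨r, rfl⟩
        induction r using Quot.ind with | _ d
        exact ⟨_, mem_darts.2 ⟨d, rfl⟩, rfl⟩
      · rintro ⟨y, hy, rfl⟩
        obtain ⟨d, rfl⟩ := mem_darts.1 hy
        exact ⟨Quot.mk _ d, rfl⟩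
    rw [← hcard, ← List.card_toFinset, Nat.card_congr (Equiv.ofInjective F hF), hrange,
      Nat.card_eq_card_toFinset]
    simp

end Check

end Code

/-- Both codes are diagrams of the same knot. -/
def SameKnot (D D' : Code) : Prop :=
  ∃ (h : D.IsKnotDiagram) (h' : D'.IsKnotDiagram),
    KnotDiagram.knot ⟨D, h⟩ = KnotDiagram.knot ⟨D', h'⟩

namespace SameKnot

variable {E D D' : Code}

theorem move (h : SameKnot E D) (hm : Code.Move D D') (hD' : Code.Check D') : SameKnot E D' := by
  obtain ⟨h1, h2, h3⟩ := h
  exact ⟨h1, hD'.isKnotDiagram, h3.trans (Quotient.sound (Relation.EqvGen.rel _ _ hm))⟩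

theorem perm (h : SameKnot E D) (hp : D.Perm D') (hD' : Code.Check D') : SameKnot E D' :=
  h.move (.reorder _ _ hp) hD'

/-- Turns the list of edges at any one crossing. -/
theorem turn {a b c d : ℕ} (h : SameKnot E D) (hp : D.Perm (.crossing a b c d :: D'))
    (h1 : Code.Check (.crossing a b c d :: D')) (h2 : Code.Check (.crossing c d a b :: D')) :
    SameKnot E (.crossing c d a b :: D') := (h.perm hp h1).move (.turn a b c d D') h2

theorem merge {a b : ℕ} (h : SameKnot E (.path a b :: D)) (hab : a ≠ b)
    (e : D.map (Node.rename fun x => if x = b then a else x) = D') (hD' : Code.Check D') :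
    SameKnot E D' := h.move (e ▸ .merge a b D hab) hD'

end SameKnot

/-! ### A diagram with seven crossings for `n = 0` -/

/-- After two moves of the third kind there is a kink, and after another one a bigon. -/
theorem exists_diagram_seven : ∃ D, SameKnot (TwistFamily.code false 1) D ∧ D.crossings = 7 := by
  have h0 : SameKnot (TwistFamily.code false 1) (TwistFamily.code false 1) :=
    ⟨TwistFamily.isKnotDiagram _ _ odd_one, TwistFamily.isKnotDiagram _ _ odd_one, rfl⟩
  have h1 : SameKnot (TwistFamily.code false 1) [.crossing 17 19 18 16, .crossing 9 5 10 19,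
    .crossing 15 14 18 10, .crossing 0 1 2 3, .crossing 4 0 5 6, .crossing 7 16 8 2,
    .crossing 6 11 1 4, .crossing 17 7 12 13, .crossing 14 15 3 8, .crossing 11 9 13 12] :=
    h0.perm (by decide +kernel) (by decide +kernel)
  have h2 : SameKnot (TwistFamily.code false 1) [.crossing 17 9 19 18, .crossing 15 10 19 5,
    .crossing 14 16 18 10, .crossing 0 1 2 3, .crossing 4 0 5 6, .crossing 7 16 8 2,
    .crossing 6 11 1 4, .crossing 17 7 12 13, .crossing 14 15 3 8, .crossing 11 9 13 12] :=
    h1.move (.r3' _ _ _ _ _ _ _ _ _ _) (by decide +kernel)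
  have h3 : SameKnot (TwistFamily.code false 1) [.crossing 19 18 17 9, .crossing 15 10 19 5,
    .crossing 14 16 18 10, .crossing 0 1 2 3, .crossing 4 0 5 6, .crossing 7 16 8 2,
    .crossing 6 11 1 4, .crossing 17 7 12 13, .crossing 14 15 3 8, .crossing 11 9 13 12] :=
    h2.turn (by decide +kernel) (by decide +kernel) (by decide +kernel)
  have h4 : SameKnot (TwistFamily.code false 1) [.crossing 12 13 17 7, .crossing 19 18 17 9,
    .crossing 15 10 19 5, .crossing 14 16 18 10, .crossing 0 1 2 3, .crossing 4 0 5 6,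
    .crossing 7 16 8 2, .crossing 6 11 1 4, .crossing 14 15 3 8, .crossing 11 9 13 12] :=
    h3.turn (by decide +kernel) (by decide +kernel) (by decide +kernel)
  have h5 : SameKnot (TwistFamily.code false 1) [.crossing 11 9 13 12, .crossing 19 18 17 9,
    .crossing 12 13 17 7, .crossing 15 10 19 5, .crossing 14 16 18 10, .crossing 0 1 2 3,
    .crossing 4 0 5 6, .crossing 7 16 8 2, .crossing 6 11 1 4, .crossing 14 15 3 8] :=
    h4.perm (by decide +kernel) (by decide +kernel)
  have h6 : SameKnot (TwistFamily.code false 1) [.crossing 19 9 13 11, .crossing 7 17 9 18,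
    .crossing 12 12 13 17, .crossing 15 10 19 5, .crossing 14 16 18 10, .crossing 0 1 2 3,
    .crossing 4 0 5 6, .crossing 7 16 8 2, .crossing 6 11 1 4, .crossing 14 15 3 8] :=
    h5.move (.r3 _ _ _ _ _ _ _ _ _ _) (by decide +kernel)
  have h7 : SameKnot (TwistFamily.code false 1) [.crossing 12 12 13 17, .crossing 19 9 13 11,
    .crossing 7 17 9 18, .crossing 15 10 19 5, .crossing 14 16 18 10, .crossing 0 1 2 3,
    .crossing 4 0 5 6, .crossing 7 16 8 2, .crossing 6 11 1 4, .crossing 14 15 3 8] :=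
    h6.perm (by decide +kernel) (by decide +kernel)
  have h8 : SameKnot (TwistFamily.code false 1) [.path 13 17, .crossing 19 9 13 11,
    .crossing 7 17 9 18, .crossing 15 10 19 5, .crossing 14 16 18 10, .crossing 0 1 2 3,
    .crossing 4 0 5 6, .crossing 7 16 8 2, .crossing 6 11 1 4, .crossing 14 15 3 8] :=
    h7.move (.r1 _ _ _ _) (by decide +kernel)
  have h9 : SameKnot (TwistFamily.code false 1) [.crossing 19 9 13 11, .crossing 7 13 9 18,
    .crossing 15 10 19 5, .crossing 14 16 18 10, .crossing 0 1 2 3, .crossing 4 0 5 6,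
    .crossing 7 16 8 2, .crossing 6 11 1 4, .crossing 14 15 3 8] :=
    h8.merge (by decide) rfl (by decide +kernel)
  have h10 : SameKnot (TwistFamily.code false 1) [.crossing 18 10 14 16, .crossing 19 9 13 11,
    .crossing 7 13 9 18, .crossing 15 10 19 5, .crossing 0 1 2 3, .crossing 4 0 5 6,
    .crossing 7 16 8 2, .crossing 6 11 1 4, .crossing 14 15 3 8] :=
    h9.turn (by decide +kernel) (by decide +kernel) (by decide +kernel)
  have h11 : SameKnot (TwistFamily.code false 1) [.crossing 3 8 14 15, .crossing 18 10 14 16,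
    .crossing 19 9 13 11, .crossing 7 13 9 18, .crossing 15 10 19 5, .crossing 0 1 2 3,
    .crossing 4 0 5 6, .crossing 7 16 8 2, .crossing 6 11 1 4] :=
    h10.turn (by decide +kernel) (by decide +kernel) (by decide +kernel)
  have h12 : SameKnot (TwistFamily.code false 1) [.crossing 7 16 8 2, .crossing 18 10 14 16,
    .crossing 3 8 14 15, .crossing 19 9 13 11, .crossing 7 13 9 18, .crossing 15 10 19 5,
    .crossing 0 1 2 3, .crossing 4 0 5 6, .crossing 6 11 1 4] :=
    h11.perm (by decide +kernel) (by decide +kernel)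
  have h13 : SameKnot (TwistFamily.code false 1) [.crossing 18 16 8 7, .crossing 15 14 16 10,
    .crossing 3 2 8 14, .crossing 19 9 13 11, .crossing 7 13 9 18, .crossing 15 10 19 5,
    .crossing 0 1 2 3, .crossing 4 0 5 6, .crossing 6 11 1 4] :=
    h12.move (.r3 _ _ _ _ _ _ _ _ _ _) (by decide +kernel)
  have h14 : SameKnot (TwistFamily.code false 1) [.crossing 16 10 15 14, .crossing 18 16 8 7,
    .crossing 3 2 8 14, .crossing 19 9 13 11, .crossing 7 13 9 18, .crossing 15 10 19 5,
    .crossing 0 1 2 3, .crossing 4 0 5 6, .crossing 6 11 1 4] :=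
    h13.turn (by decide +kernel) (by decide +kernel) (by decide +kernel)
  have h15 : SameKnot (TwistFamily.code false 1) [.crossing 16 10 15 14, .crossing 15 10 19 5,
    .crossing 18 16 8 7, .crossing 3 2 8 14, .crossing 19 9 13 11, .crossing 7 13 9 18,
    .crossing 0 1 2 3, .crossing 4 0 5 6, .crossing 6 11 1 4] :=
    h14.perm (by decide +kernel) (by decide +kernel)
  have h16 : SameKnot (TwistFamily.code false 1) [.path 14 5, .path 16 19, .crossing 18 16 8 7,
    .crossing 3 2 8 14, .crossing 19 9 13 11, .crossing 7 13 9 18, .crossing 0 1 2 3,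
    .crossing 4 0 5 6, .crossing 6 11 1 4] :=
    h15.move (.r2 _ _ _ _ _ _ _) (by decide +kernel)
  have h17 : SameKnot (TwistFamily.code false 1) [.path 16 19, .crossing 18 16 8 7,
    .crossing 3 2 8 14, .crossing 19 9 13 11, .crossing 7 13 9 18, .crossing 0 1 2 3,
    .crossing 4 0 14 6, .crossing 6 11 1 4] :=
    h16.merge (by decide) rfl (by decide +kernel)
  have h18 : SameKnot (TwistFamily.code false 1) [.crossing 18 16 8 7, .crossing 3 2 8 14,
    .crossing 16 9 13 11, .crossing 7 13 9 18, .crossing 0 1 2 3, .crossing 4 0 14 6,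
    .crossing 6 11 1 4] :=
    h17.merge (by decide) rfl (by decide +kernel)
  exact ⟨_, h18, rfl⟩

/-! ### The crossing numbers -/

theorem KnotDiagram.crossingNumber_le (D : KnotDiagram) : D.knot.crossingNumber ≤ D.1.crossings :=
  Nat.sInf_le ⟨D, rfl, rfl⟩

theorem TwistFamily.crossings_code (p : Bool) (m : ℕ) : (code p m).crossings = 9 + m := by
  rw [← length_code p m]
  refine List.countP_eq_length.2 fun v h => ?_
  rcases List.mem_append.1 h with h | h
  · simp only [outside, List.mem_cons, List.not_mem_nil, or_false] at h
    rcases h with rfl | rfl | rfl | rfl | rfl | rfl | rfl | rfl | rfl <;> rfl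
  · obtain ⟨j, -, rfl⟩ := List.mem_map.1 h
    cases p <;> rfl

theorem K_eq {n : ℤ} {p : Bool} {m : ℕ} (hm : Odd m) (hp : decide (0 < 2 * n - 1) = p)
    (h : (2 * n - 1).natAbs = m) : K n = (TwistFamily.diagram p m hm).knot := by
  subst hp; subst h
  rfl

theorem lemma3p4 (n : ℤ) :
    (0 < n → ((K n).crossingNumber : ℤ) = 2 * n + 8) ∧
    (n = 0 → (K n).crossingNumber = 7) ∧
    (n < 0 → -2 * n + 7 ≤ ((K n).crossingNumber : ℤ) ∧
      ((K n).crossingNumber : ℤ) ≤ -2 * n + 10) := by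
  have hodd : Odd (2 * n - 1).natAbs := Int.natAbs_odd.2 ⟨n - 1, by ring⟩
  refine ⟨fun hn => ?_, fun hn => ?_, fun hn => ?_⟩
  · have hK := K_eq (n := n) (p := true) hodd (by simp; omega) rfl
    have h1 := TwistFamily.le_crossingNumber_true hodd
    have h2 := (TwistFamily.diagram true _ hodd).crossingNumber_le
    rw [← hK] at h1 h2
    rw [TwistFamily.diagram, TwistFamily.crossings_code] at h2
    omega
  · have hK := K_eq (n := n) (p := false) (m := 1) odd_one (by simp; omega) (by simp [hn])
    have h1 := TwistFamily.le_crossingNumber_one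
    obtain ⟨D, ⟨_, hD, h⟩, h7⟩ := exists_diagram_seven
    have h2 := KnotDiagram.crossingNumber_le ⟨D, hD⟩
    rw [← h, h7] at h2
    rw [hK]
    exact le_antisymm h2 h1
  · have hK := K_eq (n := n) (p := false) hodd (by simp; omega) rfl
    have h1 := TwistFamily.le_crossingNumber_false hodd (by omega)
    have h2 := (TwistFamily.diagram false _ hodd).crossingNumber_le
    rw [← hK] at h1 h2
    rw [TwistFamily.diagram, TwistFamily.crossings_code] at h2
    omega
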